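/- Let $k$ be a field of characteristic zero (not necessarily algebraically closed), let $R=k[t]$, and let $A_1=k\langle t,\partial\rangle/(\partial t-t\partial-1)$ be the first Weyl algebra over $k$, acting on $R$ by letting $t$ act by multiplication and $\partial$ by $\frac{d}{dt}$. For a right ideal $I$ of $A_1$ let $$H(I)=\{\sigma\in\operatorname{Aut}_k(A_1) : \sigma(I)\simeq I \text{ as right } A_1\text{-modules}\}.$$ For a $k$-subspace $V$ of $R$ put $\mathcal D(R,V)=\{d\in A_1 : d(R)\subseteq V\}$ (a right ideal of $A_1$), $H(V)=H(\mathcal D(R,V))$, $S(V)=\{a\in R : aV\subseteq V\}$ and $\mathcal C(R,V)=\{a\in R : aR\subseteq V\}$. For $b\in R$ put $\mathcal O(b)=\{a\in R : a'\in bR\}$. A nonzero $k$-subspace $V$ of $R$ is called primary decomposable if $\mathcal O(b)\subseteq S(V)$ for some $b\neq 0$; it is called irreducible if it is not contained in any proper ideal of $R$. For $n\in\mathbb N$ (with $n=0$ allowed) write $k[X_n]=k+t^nk[t]$. Let $n\in\mathbb N$ and let $V\subsetneq R$ be a proper, primary decomposable, irreducible subspace of $R$ such that $H(k[X_n])\subseteq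 H(V)$. Then: (i) $V$ is spanned over $k$ by monomials $t^i$; (ii) $\mathcal C(R,V)=t^nk[t]$; (iii) $V=k[X_n]$. -/

import Mathlib

open Polynomial
open scoped MulOpposite

namespace Weyl

/-- The two generators of the first Weyl algebra. -/
inductive Gen : Type
  | t : Gen
  | d : Gen

/-- The defining relation `∂ t = t ∂ + 1`. -/
inductive Rel (k : Type*) [Field k] : FreeAlgebra k Gen → FreeAlgebra k Gen → Prop
  | comm : Rel k (FreeAlgebra.ι k Gen.d * FreeAlgebra.ι k Gen.t)
      (FreeAlgebra.ι k Gen.t * FreeAlgebra.ι k Gen.d + 1)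

/-- The first Weyl algebra `A₁ = k⟨t, ∂⟩ / (∂ t - t ∂ - 1)`. -/
abbrev A₁ (k : Type*) [Field k] : Type _ := RingQuot (Rel k)

variable {k : Type*} [Field k]

/-- The element `t` of `A₁`. -/
def t : A₁ k := RingQuot.mkAlgHom k (Rel k) (FreeAlgebra.ι k Gen.t)

/-- The element `∂` of `A₁`. -/
def d : A₁ k := RingQuot.mkAlgHom k (Rel k) (FreeAlgebra.ι k Gen.d)

/-- The operators on `k[t]` by which the generators act: `t` by multiplication and `∂` by
formal differentiation. -/
noncomputable def genAction : Gen → Module.End k k[X]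
  | Gen.t => LinearMap.mulLeft k X
  | Gen.d => Polynomial.derivative

/-- The action of `A₁` on `R = k[t]` by differential operators; `act a r` is `a(r)`. -/
noncomputable def act : A₁ k →ₐ[k] Module.End k k[X] :=
  RingQuot.liftAlgHom k ⟨FreeAlgebra.lift k genAction, by
    rintro _ _ ⟨⟩
    refine LinearMap.ext fun r => ?_
    simp [genAction, add_comm]⟩

theorem act_t (r : k[X]) : act (t : A₁ k) r = X * r := by
  simp [act, t, genAction]

theorem act_d (r : k[X]) : act (d : A₁ k) r = Polynomial.derivative r := by
  simp [act, d, genAction]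

/-- A right ideal of a ring `A`: a submodule of `A` as a right `A`-module. -/
abbrev RightIdeal (A : Type*) [Ring A] : Type _ := Submodule Aᵐᵒᵖ A

/-- The right ideal `D(R, V) = {a ∈ A₁ : a(R) ⊆ V}` for a subspace `V` of `R = k[t]`. -/
noncomputable def diffOps (V : Submodule k k[X]) : RightIdeal (A₁ k) where
  carrier := {a | ∀ r : k[X], act a r ∈ V}
  add_mem' {a b} ha hb r := by
    rw [map_add]
    exact V.add_mem (ha r) (hb r)
  zero_mem' r := by
    rw [map_zero]
    exact V.zero_mem
  smul_mem' c a ha r := by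
    change act (a * c.unop) r ∈ V
    rw [map_mul]
    exact ha _

/-- The image `σ(I)` of a right ideal of `A₁` under an automorphism `σ`. -/
def mapIdeal (σ : A₁ k ≃ₐ[k] A₁ k) (I : RightIdeal (A₁ k)) : RightIdeal (A₁ k) where
  carrier := σ '' I
  add_mem' := by
    rintro _ _ ⟨a, ha, rfl⟩ ⟨b, hb, rfl⟩
    exact ⟨a + b, I.add_mem ha hb, map_add σ a b⟩
  zero_mem' := ⟨0, I.zero_mem, map_zero σ⟩
  smul_mem' := by
    rintro c _ ⟨a, ha, rfl⟩
    refine ⟨a * σ.symm c.unop, I.smul_mem (MulOpposite.op (σ.symm c.unop)) ha, ?_⟩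
    rw [map_mul, AlgEquiv.apply_symm_apply]
    rfl

theorem mem_mapIdeal {σ : A₁ k ≃ₐ[k] A₁ k} {I : RightIdeal (A₁ k)} {x : A₁ k} :
    x ∈ mapIdeal σ I ↔ ∃ a ∈ I, σ a = x := Iff.rfl

theorem mapIdeal_one (I : RightIdeal (A₁ k)) : mapIdeal 1 I = I := by
  ext x
  simp [mem_mapIdeal]

theorem mapIdeal_mul (σ τ : A₁ k ≃ₐ[k] A₁ k) (I : RightIdeal (A₁ k)) :
    mapIdeal (σ * τ) I = mapIdeal σ (mapIdeal τ I) := by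
  ext x
  simp [mem_mapIdeal]

/-- Isomorphism of right ideals as right modules. -/
def Iso {A : Type*} [Ring A] (I J : RightIdeal A) : Prop := Nonempty (I ≃ₗ[Aᵐᵒᵖ] J)

/-- An isomorphism `I ≃ J` is carried by `σ` to an isomorphism `σ(I) ≃ σ(J)`. -/
theorem Iso.map {I J : RightIdeal (A₁ k)} (h : Iso I J) (σ : A₁ k ≃ₐ[k] A₁ k) :
    Iso (mapIdeal σ I) (mapIdeal σ J) := by
  have pull : ∀ (K : RightIdeal (A₁ k)) (x : mapIdeal σ K), σ.symm x.1 ∈ K := by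
    rintro K ⟨_, a, ha, rfl⟩
    simpa using ha
  have smul_eq : ∀ (c : (A₁ k)ᵐᵒᵖ) (a : A₁ k),
      σ.symm (c • a) = MulOpposite.op (σ.symm c.unop) • σ.symm a := fun c a => by
    change σ.symm (a * c.unop) = σ.symm a * σ.symm c.unop
    rw [map_mul]
  have smul_eq' : ∀ (c : (A₁ k)ᵐᵒᵖ) (a : A₁ k),
      σ (MulOpposite.op (σ.symm c.unop) • a) = c • σ a := fun c a => by
    change σ (a * σ.symm c.unop) = σ a * c.unop
    rw [map_mul, AlgEquiv.apply_symm_apply]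
  obtain ⟨e⟩ := h
  refine ⟨LinearEquiv.ofBijective
    { toFun := fun x => ⟨σ (e ⟨σ.symm x.1, pull I x⟩), _, (e ⟨σ.symm x.1, pull I x⟩).2, rfl⟩
      map_add' := ?_
      map_smul' := ?_ } ⟨?_, ?_⟩⟩
  · intro x y
    apply Subtype.ext
    change σ (e ⟨σ.symm (x.1 + y.1), _⟩ : A₁ k) = σ (e _ : A₁ k) + σ (e _ : A₁ k)
    have h : (⟨σ.symm (x.1 + y.1), pull I (x + y)⟩ : I) =
        ⟨σ.symm x.1, pull I x⟩ + ⟨σ.symm y.1, pull I y⟩ := Subtype.ext (map_add _ _ _)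
    rw [h, map_add, Submodule.coe_add, map_add]
  · intro c x
    apply Subtype.ext
    change σ (e ⟨σ.symm (c • x.1), _⟩ : A₁ k) = c • σ (e _ : A₁ k)
    have h : (⟨σ.symm (c • x.1), pull I (c • x)⟩ : I) =
        MulOpposite.op (σ.symm c.unop) • ⟨σ.symm x.1, pull I x⟩ := Subtype.ext (smul_eq _ _)
    rw [h, map_smul, Submodule.coe_smul, smul_eq']
  · intro x y hxy
    have h1 := σ.injective (congrArg Subtype.val hxy)
    have h2 := congrArg Subtype.val (e.injective (Subtype.ext h1))
    exact Subtype.ext (σ.symm.injective h2)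
  · rintro ⟨_, b, hb, rfl⟩
    refine ⟨⟨σ (e.symm ⟨b, hb⟩), _, (e.symm ⟨b, hb⟩).2, rfl⟩, Subtype.ext ?_⟩
    simp

/-- The Stafford subgroup `H(I) = {σ ∈ Aut_k(A₁) : σ(I) ≃ I}` of a right ideal `I`. -/
def stafford (I : RightIdeal (A₁ k)) : Subgroup (A₁ k ≃ₐ[k] A₁ k) where
  carrier := {σ | Iso (mapIdeal σ I) I}
  mul_mem' {σ τ} hσ hτ := by
    change Iso (mapIdeal (σ * τ) I) I
    rw [mapIdeal_mul]
    exact ⟨(Iso.map hτ σ).some.trans (Nonempty.some hσ)⟩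
  one_mem' := by
    change Iso (mapIdeal 1 I) I
    rw [mapIdeal_one]
    exact ⟨LinearEquiv.refl _ _⟩
  inv_mem' {σ} hσ := by
    change Iso (mapIdeal σ⁻¹ I) I
    have h := Iso.map hσ σ⁻¹
    rw [← mapIdeal_mul, inv_mul_cancel, mapIdeal_one] at h
    exact ⟨h.some.symm⟩

/-- `O(b) = {a ∈ R : a' ∈ bR}`. -/
noncomputable def ringO (b : k[X]) : Subalgebra k k[X] where
  carrier := {a | b ∣ derivative a}
  mul_mem' {a c} ha hc := by
    change b ∣ derivative (a * c)
    rw [derivative_mul]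
    exact dvd_add (ha.mul_right c) (hc.mul_left a)
  add_mem' {a c} ha hc := by
    change b ∣ derivative (a + c)
    rw [derivative_add]
    exact dvd_add ha hc
  algebraMap_mem' c := by simp

/-- `S(V) = {a ∈ R : aV ⊆ V}`. -/
def stabRing (V : Submodule k k[X]) : Subalgebra k k[X] where
  carrier := {a | ∀ v ∈ V, a * v ∈ V}
  mul_mem' {a c} ha hc v hv := by
    rw [mul_assoc]
    exact ha _ (hc _ hv)
  add_mem' {a c} ha hc v hv := by
    rw [add_mul]
    exact V.add_mem (ha v hv) (hc v hv)
  algebraMap_mem' c v hv := by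
    rw [← Algebra.smul_def]
    exact V.smul_mem c hv

/-- `C(R, V) = {a ∈ R : aR ⊆ V}`. -/
def conductor (V : Submodule k k[X]) : Ideal k[X] where
  carrier := {a | ∀ r : k[X], a * r ∈ V}
  add_mem' {a c} ha hc r := by
    rw [add_mul]
    exact V.add_mem (ha r) (hc r)
  zero_mem' r := by
    rw [zero_mul]
    exact V.zero_mem
  smul_mem' c a ha r := by
    rw [smul_eq_mul, mul_comm c a, mul_assoc]
    exact ha _

/-- Primary decomposable subspaces of `R`. -/
def IsPrimaryDecomposable (V : Submodule k k[X]) : Prop :=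
  V ≠ ⊥ ∧ ∃ b : k[X], b ≠ 0 ∧ ringO b ≤ stabRing V

/-- Irreducible subspaces: those contained in no proper ideal of `R`. -/
def IsIrreducible (V : Submodule k k[X]) : Prop :=
  ∀ J : Ideal k[X], J ≠ ⊤ → ¬ ((V : Set k[X]) ⊆ J)

/-- Subspaces of `R` spanned by monomials. -/
def IsMonomial (V : Submodule k k[X]) : Prop :=
  ∃ s : Set ℕ, V = Submodule.span k ((fun i : ℕ => (X ^ i : k[X])) '' s)

/-- `k[X_n] = k + tⁿ k[t]`. -/
noncomputable def coordRing (k : Type*) [Field k] (n : ℕ) : Submodule k k[X] :=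
  Submodule.span k {1} ⊔ (Ideal.span {(X ^ n : k[X])}).restrictScalars k

end Weyl

/-! The group `H(k[X_n])` contains three families of automorphisms, and each forces part of the
shape of `V`. Write `n = N + 1`. Then `D(R, k[X_n])` consists of the `x` with `∂x ∈ t^N A₁`.

The shears `∂ ↦ ∂ + g` with `t^N ∣ g` and the torus `t ↦ ct` preserve this ideal. For `D(R, V)` they
give isomorphisms between ideals with the same intersection with `k[t]`, and such ideals are equal
(`Iso.eq_of_inter`). Differentiating along the shears puts `t^n R` inside `S(V)`, hence `t^n R ⊆ V`
by irreducibility. The torus makes `V` monomial. So `V` is given by the vanishing of the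
coefficients with index in a gap set `G ⊆ {1, ..., N}` (`exists_gaps`).

The third family is `Ψ⁻¹ ∘ shear ∘ Ψ` with `Ψ : t ↦ t + h(∂)`. The class of `{x : ∂x ∈ aA₁}` depends
only on `a` modulo `∂A₁`, so `Ψ` carries the ideal for `t^N` to one isomorphic to that for a
polynomial `τ`, and shears by multiples of `τ` lift back to `H(k[X_n])` (`conj_shear_mem_stafford`).

To see when such an element can lie in `H(V)`, dualize: right linear maps `D(R, V) → A₁` correspond
to the left ideal of operators killing `t^g` for `g ∈ G`. After transport by `Ψ` this becomes the
annihilator of the polynomials `T(t^g)`, where `T` intertwines the two actions, and it carries a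
shear-semilinear bijection. Hence its element of least order `ρ ≤ |G|` has a leading coefficient
dividing a power of `τ` (`exists_minimal_dvd_pow`). If `τ(0) ≠ 0`, that operator is injective on
`t^ρ R`, so no `T(t^g)` is divisible by `t^|G|` (`not_mem_stafford`).

Two choices of `h` finish the proof: `h = t^(N-1)` gives `N ∈ G`, and a truncation of `1/(1+t)` then
gives `|G| = N`. -/

set_option linter.unusedSimpArgs false

namespace Weyl

/-! ### Order filtration, leading coefficients, and faithfulness of the action. -/

section Order

variable {k : Type*} [Field k]

theorem d_mul_t : (d * t : A₁ k) = t * d + 1 := by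
  have h := RingQuot.mkAlgHom_rel k (Rel.comm (k := k))
  simpa [d, t] using h

/-- Every property of elements of `A₁` that is stable under the ring operations and holds for the
scalars and the generators holds everywhere. -/
theorem weyl_induction {C : A₁ k → Prop} (hs : ∀ c : k, C (algebraMap k _ c)) (ht : C t) (hd : C d)
    (hmul : ∀ a b, C a → C b → C (a * b)) (hadd : ∀ a b, C a → C b → C (a + b)) (a : A₁ k) :
    C a := by
  obtain ⟨x, rfl⟩ := RingQuot.mkAlgHom_surjective k (Rel k) a
  induction x using FreeAlgebra.induction with
  | grade0 r => simpa using hs r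
  | grade1 x => cases x; exacts [ht, hd]
  | mul a b ha hb => rw [map_mul]; exact hmul _ _ ha hb
  | add a b ha hb => rw [map_add]; exact hadd _ _ ha hb

theorem weyl_hom_ext {B : Type*} [Semiring B] [Algebra k B] {f g : A₁ k →ₐ[k] B}
    (ht : f t = g t) (hd : f d = g d) : f = g := by
  refine AlgHom.ext fun a => ?_
  induction a using weyl_induction with
  | hs c => simp
  | ht => exact ht
  | hd => exact hd
  | hmul a b ha hb => rw [map_mul, map_mul, ha, hb]
  | hadd a b ha hb => rw [map_add, map_add, ha, hb]

/-- A polynomial, viewed as an element of `A₁`. -/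
noncomputable def pt : k[X] →ₐ[k] A₁ k := aeval t

@[simp] theorem pt_X : pt (X : k[X]) = t := aeval_X _

@[simp] theorem act_pt (f r : k[X]) : act (pt f) r = f * r := by
  induction f using Polynomial.induction_on' with
  | add p q hp hq => rw [map_add, map_add, LinearMap.add_apply, hp, hq, add_mul]
  | monomial n a =>
    rw [← C_mul_X_pow_eq_monomial, map_mul, map_pow, pt_X, map_mul, map_pow]
    have h1 : ∀ r : k[X], ((act (t : A₁ k)) ^ n) r = X ^ n * r := by
      intro r
      induction n with
      | zero => simp
      | succ n ih => rw [pow_succ', Module.End.mul_apply, ih, act_t, pow_succ']; ring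
    have h2 : (pt (C a) : A₁ k) = algebraMap k _ a := by
      rw [← Polynomial.algebraMap_eq, AlgHom.commutes]
    rw [h2, AlgHom.commutes, Module.End.mul_apply, h1, Module.algebraMap_end_apply, smul_eq_C_mul]
    ring

theorem pt_injective : Function.Injective (pt : k[X] → A₁ k) := by
  intro f g h
  simpa using congrArg (fun a => act a 1) h

theorem pt_comm (f g : k[X]) : (pt f * pt g : A₁ k) = pt g * pt f := by
  rw [← map_mul, mul_comm, map_mul]

theorem t_comm_pt (f : k[X]) : (t * pt f : A₁ k) = pt f * t := by
  rw [← pt_X, pt_comm]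

theorem d_mul_pt (f : k[X]) : (d * pt f : A₁ k) = pt f * d + pt (derivative f) := by
  induction f using Polynomial.induction_on with
  | C a =>
    have h2 : (pt (C a) : A₁ k) = algebraMap k _ a := by
      rw [← Polynomial.algebraMap_eq, AlgHom.commutes]
    rw [derivative_C, map_zero, add_zero, h2, Algebra.commutes]
  | add p q hp hq => rw [map_add, mul_add, hp, hq, derivative_add, map_add]; simp only [sub_mul, mul_sub, add_mul, mul_add, mul_assoc]; abel
  | monomial n a h =>
    have hX : derivative (C a * X ^ n * X) = derivative (C a * X ^ n) * X + C a * X ^ n := by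
      rw [derivative_mul, derivative_X, mul_one]
    rw [pow_succ, ← mul_assoc (C a), hX, map_mul pt (C a * X ^ n), ← mul_assoc d, h, map_add,
      map_mul pt (derivative _), pt_X, add_mul, mul_assoc _ d, d_mul_t]
    simp only [mul_add, mul_one, mul_assoc]
    abel

/-- The operators of order less than `m`. -/
noncomputable def Fil : ℕ → Submodule k (A₁ k)
  | 0 => ⊥
  | m + 1 => Fil m ⊔ LinearMap.range (LinearMap.mulRight k (d ^ m : A₁ k) ∘ₗ pt.toLinearMap)

theorem mem_Fil_zero {a : A₁ k} : a ∈ Fil (k := k) 0 ↔ a = 0 := Iff.rfl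

theorem mem_Fil_succ {m : ℕ} {a : A₁ k} :
    a ∈ Fil (k := k) (m + 1) ↔ ∃ α : k[X], a - pt α * d ^ m ∈ Fil (k := k) m := by
  constructor
  · intro h
    obtain ⟨b, hb, c, ⟨α, rfl⟩, rfl⟩ := Submodule.mem_sup.1 h
    exact ⟨α, by simpa using hb⟩
  · rintro ⟨α, h⟩
    exact Submodule.mem_sup.2 ⟨_, h, _, ⟨α, rfl⟩, by simp⟩

theorem Fil_le_succ (m : ℕ) : Fil (k := k) m ≤ Fil (m + 1) := fun _ h => Submodule.mem_sup_left h

theorem Fil_mono {m l : ℕ} (h : m ≤ l) : Fil (k := k) m ≤ Fil l :=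
  monotone_nat_of_le_succ Fil_le_succ h

theorem pt_mul_pow_mem_Fil (α : k[X]) (m : ℕ) : (pt α * d ^ m : A₁ k) ∈ Fil (k := k) (m + 1) :=
  mem_Fil_succ.2 ⟨α, by simp⟩

theorem pt_mul_mem_Fil (f : k[X]) {m : ℕ} {a : A₁ k} (h : a ∈ Fil (k := k) m) :
    pt f * a ∈ Fil (k := k) m := by
  induction m generalizing a with
  | zero => rw [mem_Fil_zero] at *; rw [h, mul_zero]
  | succ m ih =>
    obtain ⟨α, h⟩ := mem_Fil_succ.1 h
    refine mem_Fil_succ.2 ⟨f * α, ?_⟩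
    have := ih h
    rwa [mul_sub, ← mul_assoc, ← map_mul] at this

theorem d_mul_mem_Fil {m : ℕ} {a : A₁ k} (h : a ∈ Fil (k := k) m) :
    d * a ∈ Fil (k := k) (m + 1) := by
  induction m generalizing a with
  | zero => rw [mem_Fil_zero] at h; rw [h, mul_zero]; exact zero_mem _
  | succ m ih =>
    obtain ⟨α, h⟩ := mem_Fil_succ.1 h
    refine mem_Fil_succ.2 ⟨α, ?_⟩
    have h2 := add_mem (ih h) (pt_mul_mem_Fil 1 (pt_mul_pow_mem_Fil (derivative α) m))
    convert h2 using 1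
    rw [mul_sub, ← mul_assoc d (pt α), d_mul_pt, map_one, one_mul, add_mul, mul_assoc, ← pow_succ']
    abel

theorem d_pow_mul_mem_Fil (i : ℕ) {m : ℕ} {a : A₁ k} (h : a ∈ Fil (k := k) m) :
    d ^ i * a ∈ Fil (k := k) (m + i) := by
  induction i with
  | zero => simpa using h
  | succ i ih => rw [pow_succ', mul_assoc]; exact d_mul_mem_Fil ih

theorem mul_mem_Fil {m l : ℕ} {a b : A₁ k} (ha : a ∈ Fil (k := k) m)
    (hb : b ∈ Fil (k := k) (l + 1)) : a * b ∈ Fil (k := k) (m + l) := by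
  induction m generalizing a with
  | zero => rw [mem_Fil_zero] at ha; rw [ha, zero_mul]; exact zero_mem _
  | succ m ih =>
    obtain ⟨α, h⟩ := mem_Fil_succ.1 ha
    have h1 := Fil_mono (by omega : m + l ≤ m + 1 + l) (ih h)
    have h2 := pt_mul_mem_Fil α (d_pow_mul_mem_Fil m hb)
    have h3 := add_mem h1 (Fil_mono (by omega : l + 1 + m ≤ m + 1 + l) h2)
    convert h3 using 1
    simp only [sub_mul, mul_sub, add_mul, mul_add, mul_assoc]; abel

/-- `a` has order at most `m`, and its coefficient at `∂ᵐ` is `α`. -/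
def HasLead (a : A₁ k) (m : ℕ) (α : k[X]) : Prop := a - pt α * d ^ m ∈ Fil (k := k) m

theorem mem_Fil_succ_iff_hasLead {m : ℕ} {a : A₁ k} :
    a ∈ Fil (k := k) (m + 1) ↔ ∃ α, HasLead a m α := mem_Fil_succ

theorem HasLead.mem {a : A₁ k} {m : ℕ} {α : k[X]} (h : HasLead a m α) :
    a ∈ Fil (k := k) (m + 1) := mem_Fil_succ.2 ⟨α, h⟩

theorem hasLead_zero_iff {a : A₁ k} {m : ℕ} : HasLead a m 0 ↔ a ∈ Fil (k := k) m := by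
  simp [HasLead]

theorem hasLead_pt_mul_pow (α : k[X]) (m : ℕ) : HasLead (pt α * d ^ m) m α := by
  simp [HasLead]

theorem hasLead_pt (α : k[X]) : HasLead (pt α) 0 α := by
  simp [HasLead]

theorem hasLead_d_pow (m : ℕ) : HasLead (d ^ m : A₁ k) m 1 := by
  simp [HasLead]

theorem hasLead_d : HasLead (d : A₁ k) 1 1 := by
  simpa using hasLead_d_pow (k := k) 1

theorem HasLead.add {a b : A₁ k} {m : ℕ} {α β : k[X]} (ha : HasLead a m α) (hb : HasLead b m β) :
    HasLead (a + b) m (α + β) := by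
  have := add_mem ha hb
  unfold HasLead
  convert this using 1
  rw [map_add]; simp only [sub_mul, mul_sub, add_mul, mul_add, mul_assoc]; abel

theorem HasLead.sub {a b : A₁ k} {m : ℕ} {α β : k[X]} (ha : HasLead a m α) (hb : HasLead b m β) :
    HasLead (a - b) m (α - β) := by
  have := sub_mem ha hb
  unfold HasLead
  convert this using 1
  rw [map_sub]; simp only [sub_mul, mul_sub, add_mul, mul_add, mul_assoc]; abel

theorem HasLead.d_mul {b : A₁ k} {l : ℕ} {β : k[X]} (hb : HasLead b l β) :
    HasLead (d * b) (l + 1) β := by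
  have h1 := add_mem (d_mul_mem_Fil hb) (pt_mul_pow_mem_Fil (derivative β) l)
  unfold HasLead
  convert h1 using 1
  rw [mul_sub, ← mul_assoc d (pt β), d_mul_pt, add_mul, mul_assoc, ← pow_succ']
  abel

theorem HasLead.d_pow_mul {b : A₁ k} {l : ℕ} {β : k[X]} (hb : HasLead b l β) (m : ℕ) :
    HasLead (d ^ m * b) (m + l) β := by
  induction m with
  | zero => simpa using hb
  | succ m ih =>
    rw [pow_succ', mul_assoc, show m + 1 + l = m + l + 1 by omega]
    exact ih.d_mul

theorem HasLead.pt_mul {b : A₁ k} {l : ℕ} {β : k[X]} (hb : HasLead b l β) (α : k[X]) :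
    HasLead (pt α * b) l (α * β) := by
  have := pt_mul_mem_Fil α hb
  unfold HasLead
  rwa [mul_sub, ← mul_assoc, ← map_mul] at this

theorem HasLead.mul {a b : A₁ k} {m l : ℕ} {α β : k[X]} (ha : HasLead a m α)
    (hb : HasLead b l β) : HasLead (a * b) (m + l) (α * β) := by
  have h1 := mul_mem_Fil ha hb.mem
  have h2 := (hb.d_pow_mul m).pt_mul α
  have h3 := (hasLead_zero_iff.2 h1).add h2
  rw [zero_add] at h3
  convert h3 using 1
  simp only [sub_mul, mul_sub, add_mul, mul_add, mul_assoc]; abel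

theorem exists_mem_Fil (a : A₁ k) : ∃ m, a ∈ Fil (k := k) m := by
  -- Finite order is stable under left multiplication by `a`; in this form the induction on `a`
  -- passes through products.
  suffices h : ∀ m, ∀ b ∈ Fil (k := k) m, ∃ m', a * b ∈ Fil (k := k) m' by
    simpa using h 1 1 (by simpa using (hasLead_pt (1 : k[X])).mem)
  induction a using weyl_induction with
  | hs c =>
    intro m b hb
    exact ⟨m, by rw [← Algebra.smul_def]; exact Submodule.smul_mem _ _ hb⟩
  | ht => exact fun m b hb => ⟨m, by rw [← pt_X]; exact pt_mul_mem_Fil _ hb⟩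
  | hd => exact fun m b hb => ⟨m + 1, d_mul_mem_Fil hb⟩
  | hmul x y hx hy =>
    intro m b hb
    obtain ⟨m1, h1⟩ := hy m b hb
    obtain ⟨m2, h2⟩ := hx m1 _ h1
    exact ⟨m2, by rwa [mul_assoc]⟩
  | hadd x y hx hy =>
    intro m b hb
    obtain ⟨m1, h1⟩ := hx m b hb
    obtain ⟨m2, h2⟩ := hy m b hb
    exact ⟨max m1 m2, by
      rw [add_mul]
      exact add_mem (Fil_mono (le_max_left _ _) h1) (Fil_mono (le_max_right _ _) h2)⟩

theorem exists_pt_add_mul_d (a : A₁ k) : ∃ f b, a = pt f + b * d := by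
  obtain ⟨m, hm⟩ := exists_mem_Fil a
  induction m generalizing a with
  | zero => exact ⟨0, 0, by simpa using mem_Fil_zero.1 hm⟩
  | succ m ih =>
    obtain ⟨α, h⟩ := mem_Fil_succ.1 hm
    obtain ⟨f, b, hf⟩ := ih _ h
    rw [sub_eq_iff_eq_add] at hf
    cases m with
    | zero => exact ⟨f + α, b, by rw [hf, map_add]; simp; abel⟩
    | succ m => exact ⟨f, b + pt α * d ^ m, by rw [hf, pow_succ]; simp only [sub_mul, mul_sub, add_mul, mul_add, mul_assoc]; abel⟩

/-- The annihilator of `1` is `A₁∂`: this presents `k[t]` as `A₁/A₁∂`. -/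
theorem exists_mul_d_of_act_one {a : A₁ k} (h : act a 1 = 0) : ∃ b, a = b * d := by
  obtain ⟨f, b, rfl⟩ := exists_pt_add_mul_d a
  have : f = 0 := by simpa [map_mul, act_d] using h
  exact ⟨b, by simp [this]⟩

theorem d_pow_mul_t (m : ℕ) : (d ^ (m + 1) * t : A₁ k) = t * d ^ (m + 1) + (m + 1 : ℕ) • d ^ m := by
  induction m with
  | zero => simpa using d_mul_t
  | succ m ih =>
    rw [pow_succ', mul_assoc, ih, mul_add, ← mul_assoc, d_mul_t, mul_smul_comm, ← pow_succ',
      add_mul, mul_assoc, ← pow_succ', one_mul, succ_nsmul _ (m + 1)]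
    abel

theorem comm_t_pt_mul_pow (α : k[X]) (m : ℕ) :
    (pt α * d ^ (m + 1) * t - t * (pt α * d ^ (m + 1)) : A₁ k)
      = pt (((m + 1 : ℕ) : k[X]) * α) * d ^ m := by
  rw [mul_assoc, d_pow_mul_t, ← mul_assoc t, t_comm_pt, map_mul, map_natCast, mul_add, nsmul_eq_mul,
    ← mul_assoc (pt α) _ (d ^ m), (Nat.cast_commute (m + 1) (pt α : A₁ k)).eq]
  simp only [sub_mul, mul_sub, add_mul, mul_add, mul_assoc]; abel

theorem comm_t_mem_Fil {m : ℕ} {a : A₁ k} (h : a ∈ Fil (k := k) (m + 1)) :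
    a * t - t * a ∈ Fil (k := k) m := by
  induction m generalizing a with
  | zero =>
    obtain ⟨α, h⟩ := mem_Fil_succ.1 h
    rw [mem_Fil_zero, pow_zero, mul_one, sub_eq_zero] at h
    rw [h, t_comm_pt, sub_self]
    exact zero_mem _
  | succ m ih =>
    obtain ⟨α, h⟩ := mem_Fil_succ.1 h
    refine mem_Fil_succ.2 ⟨((m + 1 : ℕ) : k[X]) * α, ?_⟩
    rw [← comm_t_pt_mul_pow]
    convert ih h using 1
    simp only [sub_mul, mul_sub, add_mul, mul_add, mul_assoc]; abel

theorem exists_hasLead {a : A₁ k} {m : ℕ} (hm : a ∈ Fil (k := k) m) (ha : a ≠ 0) :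
    ∃ l < m, ∃ α, α ≠ 0 ∧ HasLead a l α := by
  induction m with
  | zero => exact absurd (mem_Fil_zero.1 hm) ha
  | succ m ih =>
    obtain ⟨α, h⟩ := mem_Fil_succ.1 hm
    by_cases hα : α = 0
    · subst hα
      obtain ⟨l, hl, h'⟩ := ih (by simpa using h)
      exact ⟨l, by omega, h'⟩
    · exact ⟨m, by omega, α, hα, h⟩

theorem exists_hasLead' {a : A₁ k} (ha : a ≠ 0) : ∃ l α, α ≠ 0 ∧ HasLead a l α := by
  obtain ⟨m, hm⟩ := exists_mem_Fil a
  obtain ⟨l, _, h⟩ := exists_hasLead hm ha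
  exact ⟨l, h⟩

variable [CharZero k]

/-- The commutator with `t` lowers the order by one and multiplies the coefficient of `∂^(m+1)` by
`m + 1`, which is invertible in characteristic zero. -/
theorem eq_zero_of_pt_mul_pow_mem_Fil {m : ℕ} {α : k[X]}
    (h : (pt α * d ^ m : A₁ k) ∈ Fil (k := k) m) : α = 0 := by
  induction m generalizing α with
  | zero =>
    rw [mem_Fil_zero, pow_zero, mul_one] at h
    exact pt_injective (h.trans (map_zero pt).symm)
  | succ m ih =>
    have h1 := comm_t_mem_Fil h
    rw [comm_t_pt_mul_pow] at h1
    have := ih h1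
    rcases mul_eq_zero.1 this with h2 | h2
    · exact absurd h2 (Nat.cast_ne_zero.2 (Nat.succ_ne_zero m))
    · exact h2

theorem HasLead.eq_zero {a : A₁ k} {m : ℕ} {α : k[X]} (h : HasLead a m α)
    (h' : a ∈ Fil (k := k) m) : α = 0 := by
  refine eq_zero_of_pt_mul_pow_mem_Fil (m := m) ?_
  have := sub_mem h' h
  simpa using this

theorem HasLead.unique {a : A₁ k} {m : ℕ} {α β : k[X]} (h : HasLead a m α)
    (h' : HasLead a m β) : α = β := by
  have := h.sub h'
  rw [sub_self] at this
  exact sub_eq_zero.1 (this.eq_zero (zero_mem _))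

theorem HasLead.eq_of_ne {a : A₁ k} {m l : ℕ} {α β : k[X]} (h : HasLead a m α)
    (h' : HasLead a l β) (hα : α ≠ 0) (hβ : β ≠ 0) : m = l := by
  rcases lt_trichotomy m l with hl | hl | hl
  · exact absurd (h'.eq_zero (Fil_mono hl h.mem)) hβ
  · exact hl
  · exact absurd (h.eq_zero (Fil_mono hl h'.mem)) hα

theorem HasLead.ne_zero {a : A₁ k} {m : ℕ} {α : k[X]} (h : HasLead a m α) (hα : α ≠ 0) : a ≠ 0 := by
  rintro rfl
  exact hα (h.eq_zero (zero_mem _))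

theorem weyl_mul_ne_zero {a b : A₁ k} (ha : a ≠ 0) (hb : b ≠ 0) : a * b ≠ 0 := by
  obtain ⟨m, α, hα, h⟩ := exists_hasLead' ha
  obtain ⟨l, β, hβ, h'⟩ := exists_hasLead' hb
  exact (h.mul h').ne_zero (mul_ne_zero hα hβ)

instance : NoZeroDivisors (A₁ k) where
  eq_zero_or_eq_zero_of_mul_eq_zero {a b} h := by
    by_contra! hc
    exact weyl_mul_ne_zero hc.1 hc.2 h

/-- An operator whose values are all divisible by `g` is a left multiple of `g`. -/
theorem exists_eq_pt_mul {g : k[X]} {a : A₁ k} (h : ∀ r, g ∣ act a r) : ∃ b, a = pt g * b := by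
  have main : ∀ m, ∀ a ∈ Fil (k := k) m, (∀ r, g ∣ act a r) → ∃ b, a = pt g * b := by
    -- Commuting with `t` keeps all values divisible by `g` and lowers the order, so the leading
    -- coefficient is divisible by `g` and the leading term can be split off.
    have key : ∀ m, ∀ a : A₁ k, ∀ α, HasLead a m α → (∀ r, g ∣ act a r) → g ∣ α := by
      intro m
      induction m with
      | zero =>
        intro a α h1 h2
        rw [HasLead, mem_Fil_zero, pow_zero, mul_one, sub_eq_zero] at h1
        simpa [h1] using h2 1
      | succ m ih =>
        intro a α h1 h2
        have h3 : HasLead (a * t - t * a) m (((m + 1 : ℕ) : k[X]) * α) := by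
          unfold HasLead
          rw [← comm_t_pt_mul_pow]
          convert comm_t_mem_Fil h1 using 1
          simp only [sub_mul, mul_sub, add_mul, mul_add, mul_assoc]; abel
        have h4 := ih _ _ h3 fun r => by
          rw [map_sub, LinearMap.sub_apply, map_mul, map_mul, Module.End.mul_apply,
            Module.End.mul_apply, act_t (act a r)]
          exact dvd_sub (h2 _) ((h2 r).mul_left _)
        have h5 : IsUnit ((m + 1 : ℕ) : k[X]) := by
          rw [← map_natCast (C : k →+* k[X])]
          exact isUnit_C.2 (Ne.isUnit (Nat.cast_ne_zero.2 (Nat.succ_ne_zero m)))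
        exact (h5.dvd_mul_left).1 h4
    intro m
    induction m with
    | zero => exact fun a ha _ => ⟨0, by simpa using mem_Fil_zero.1 ha⟩
    | succ m ih =>
      intro a ha h2
      obtain ⟨α, h3⟩ := mem_Fil_succ.1 ha
      obtain ⟨β, rfl⟩ := key m a α h3 h2
      obtain ⟨b, hb⟩ := ih _ h3 fun r => by
        rw [map_sub, LinearMap.sub_apply, map_mul, map_mul, map_mul, Module.End.mul_apply,
          Module.End.mul_apply, act_pt]
        exact dvd_sub (h2 r) (dvd_mul_right _ _)
      exact ⟨b + pt β * d ^ m, by rw [mul_add, ← hb, ← mul_assoc, ← map_mul]; abel⟩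
  obtain ⟨m, hm⟩ := exists_mem_Fil a
  exact main m a hm h

theorem act_injective : Function.Injective (act : A₁ k → Module.End k k[X]) := by
  intro a b hab
  -- Divisibility by `0` means that all values vanish.
  obtain ⟨c, hc⟩ := exists_eq_pt_mul (g := 0) (a := a - b) fun r => by simp [map_sub, hab]
  rw [map_zero, zero_mul] at hc
  exact sub_eq_zero.1 hc

end Order

/-! ### Shears, dual shears, the torus, and intertwining maps. -/

section Automorphisms

variable {k : Type*} [Field k]

/-- The endomorphism of `A₁` given by a pair of elements satisfying the defining relation. -/
noncomputable def weylHom (x y : A₁ k) (h : y * x = x * y + 1) : A₁ k →ₐ[k] A₁ k :=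
  RingQuot.liftAlgHom k ⟨FreeAlgebra.lift k (fun i : Gen => Gen.casesOn i x y), by
    rintro _ _ ⟨⟩
    simpa using h⟩

@[simp] theorem weylHom_t (x y : A₁ k) (h : y * x = x * y + 1) : weylHom x y h t = x := by
  simp [weylHom, t]

@[simp] theorem weylHom_d (x y : A₁ k) (h : y * x = x * y + 1) : weylHom x y h d = y := by
  simp [weylHom, d]

theorem shear_rel (g : k[X]) : ((d + pt g) * t : A₁ k) = t * (d + pt g) + 1 := by
  rw [add_mul, mul_add, d_mul_t, t_comm_pt]; abel

theorem weylHom_shear_pt (g f : k[X]) : weylHom t (d + pt g) (shear_rel g) (pt f) = pt f := by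
  have := aeval_algHom_apply (weylHom t (d + pt g) (shear_rel g)) t f
  rw [weylHom_t] at this
  exact this.symm

theorem weylHom_shear_neg (g : k[X]) : (weylHom t (d + pt g) (shear_rel g)).comp
    (weylHom t (d + pt (-g)) (shear_rel (-g))) = AlgHom.id k _ :=
  weyl_hom_ext (by simp) (by
    rw [AlgHom.comp_apply, weylHom_d, map_add, weylHom_shear_pt, weylHom_d, map_neg]; simp)

/-- The automorphism `t ↦ t`, `∂ ↦ ∂ + g(t)`. -/
noncomputable def shear (g : k[X]) : A₁ k ≃ₐ[k] A₁ k :=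
  AlgEquiv.ofAlgHom (weylHom t (d + pt g) (shear_rel g)) (weylHom t (d + pt (-g)) (shear_rel (-g)))
    (weylHom_shear_neg g) (by simpa only [neg_neg] using weylHom_shear_neg (-g))

@[simp] theorem shear_t (g : k[X]) : shear g t = t := weylHom_t _ _ _

@[simp] theorem shear_d (g : k[X]) : shear g d = d + pt g := weylHom_d _ _ _

@[simp] theorem shear_pt (g f : k[X]) : shear g (pt f) = pt f := by
  have := aeval_algHom_apply (shear g : A₁ k ≃ₐ[k] A₁ k).toAlgHom t f
  simpa [pt] using this.symm

theorem shear_inv (g : k[X]) : (shear g)⁻¹ = shear (-g) := AlgEquiv.ext fun _ => rfl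

/-- A polynomial in `∂`. -/
noncomputable def pd : k[X] →ₐ[k] A₁ k := aeval d

theorem d_comm_pd (f : k[X]) : (d * pd f : A₁ k) = pd f * d := by
  have h : (pd X : A₁ k) = d := aeval_X _
  rw [← h, ← map_mul, mul_comm, map_mul]

theorem dualShear_rel (h : k[X]) : (d * (t + pd h) : A₁ k) = (t + pd h) * d + 1 := by
  rw [add_mul, mul_add, d_mul_t, d_comm_pd]; abel

theorem weylHom_dualShear_pd (h f : k[X]) :
    weylHom (t + pd h) d (dualShear_rel h) (pd f) = pd f := by
  have := aeval_algHom_apply (weylHom (t + pd h) d (dualShear_rel h)) d f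
  rw [weylHom_d] at this
  exact this.symm

theorem weylHom_dualShear_neg (h : k[X]) : (weylHom (t + pd h) d (dualShear_rel h)).comp
    (weylHom (t + pd (-h)) d (dualShear_rel (-h))) = AlgHom.id k _ :=
  weyl_hom_ext (by
    rw [AlgHom.comp_apply, weylHom_t, map_add, weylHom_dualShear_pd, weylHom_t, map_neg]; simp)
    (by simp)

/-- The automorphism `t ↦ t + h(∂)`, `∂ ↦ ∂`. -/
noncomputable def dualShear (h : k[X]) : A₁ k ≃ₐ[k] A₁ k :=
  AlgEquiv.ofAlgHom (weylHom (t + pd h) d (dualShear_rel h))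
    (weylHom (t + pd (-h)) d (dualShear_rel (-h)))
    (weylHom_dualShear_neg h) (by simpa only [neg_neg] using weylHom_dualShear_neg (-h))

@[simp] theorem dualShear_t (h : k[X]) : dualShear h t = t + pd h := weylHom_t _ _ _

@[simp] theorem dualShear_d (h : k[X]) : dualShear h d = (d : A₁ k) := weylHom_d _ _ _

theorem torus_rel {c : k} (hc : c ≠ 0) :
    ((c⁻¹ • d) * (c • t) : A₁ k) = (c • t) * (c⁻¹ • d) + 1 := by
  rw [smul_mul_smul_comm, smul_mul_smul_comm, inv_mul_cancel₀ hc, mul_inv_cancel₀ hc, one_smul,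
    one_smul, d_mul_t]

/-- The automorphism `t ↦ c t`, `∂ ↦ c⁻¹ ∂`. -/
noncomputable def torus {c : k} (hc : c ≠ 0) : A₁ k ≃ₐ[k] A₁ k :=
  AlgEquiv.ofAlgHom (weylHom (c • t) (c⁻¹ • d) (torus_rel hc))
    (weylHom (c⁻¹ • t) (c⁻¹⁻¹ • d) (torus_rel (inv_ne_zero hc)))
    (weyl_hom_ext (by simp [smul_smul, hc]) (by simp [smul_smul, hc]))
    (weyl_hom_ext (by simp [smul_smul, hc]) (by simp [smul_smul, hc]))

@[simp] theorem torus_t {c : k} (hc : c ≠ 0) : torus hc t = c • (t : A₁ k) := weylHom_t _ _ _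

@[simp] theorem torus_d {c : k} (hc : c ≠ 0) : torus hc d = c⁻¹ • (d : A₁ k) := weylHom_d _ _ _

theorem act_torus {c : k} (hc : c ≠ 0) (a : A₁ k) (f : k[X]) :
    act (torus hc a) (f.comp (C c * X)) = (act a f).comp (C c * X) := by
  induction a using weyl_induction generalizing f with
  | hs r => simp [Module.algebraMap_end_apply]
  | ht => rw [torus_t, map_smul, LinearMap.smul_apply, act_t, act_t, mul_comp, X_comp, smul_eq_C_mul,
      mul_assoc]
  | hd =>
    rw [torus_d, map_smul, LinearMap.smul_apply, act_d, act_d, derivative_comp, derivative_C_mul,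
      derivative_X, mul_one, smul_eq_C_mul, ← mul_assoc, ← C_mul, inv_mul_cancel₀ hc, C_1, one_mul]
  | hmul a b ha hb => rw [map_mul, map_mul, Module.End.mul_apply, hb, ha, map_mul]; rfl
  | hadd a b ha hb => rw [map_add, map_add, LinearMap.add_apply, ha, hb, map_add,
      LinearMap.add_apply, add_comp]

/-- For an automorphism fixing `∂`, the linear map of `k[t]` that intertwines the action of `A₁`
with the twisted action. -/
noncomputable def intertwiner (σ : A₁ k ≃ₐ[k] A₁ k) : k[X] →ₗ[k] k[X] :=
  LinearMap.applyₗ (1 : k[X]) ∘ₗ act.toLinearMap ∘ₗ σ.toLinearMap ∘ₗ pt.toLinearMap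

theorem intertwiner_apply (σ : A₁ k ≃ₐ[k] A₁ k) (f : k[X]) :
    intertwiner σ f = act (σ (pt f)) 1 := rfl

/-- An automorphism fixing `∂` preserves `A₁∂`, hence descends to `A₁/A₁∂ = k[t]`; `intertwiner σ`
is the induced map. -/
theorem intertwiner_act {σ : A₁ k ≃ₐ[k] A₁ k} (hσ : σ d = d) (a : A₁ k) (f : k[X]) :
    intertwiner σ (act a f) = act (σ a) (intertwiner σ f) := by
  induction a using weyl_induction generalizing f with
  | hs r => simp [Module.algebraMap_end_apply]
  | ht => rw [act_t, intertwiner_apply, intertwiner_apply, map_mul, map_mul, pt_X, map_mul,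
      Module.End.mul_apply]
  | hd =>
    have h : (pt (derivative f) : A₁ k) = d * pt f - pt f * d := by rw [d_mul_pt]; abel
    rw [act_d, intertwiner_apply, intertwiner_apply, h, hσ, map_sub, map_mul, map_mul, hσ, map_sub,
      LinearMap.sub_apply, map_mul, map_mul, Module.End.mul_apply, Module.End.mul_apply, act_d 1,
      derivative_one, map_zero, sub_zero]
  | hmul a b ha hb => simp only [map_mul, Module.End.mul_apply, ha, hb]
  | hadd a b ha hb => simp only [map_add, LinearMap.add_apply, ha, hb]

theorem intertwiner_injective {σ : A₁ k ≃ₐ[k] A₁ k} (hσ : σ d = d) :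
    Function.Injective (intertwiner σ) := by
  have hσ' : σ.symm d = d := by rw [AlgEquiv.symm_apply_eq, hσ]
  have h : ∀ f, intertwiner σ.symm (intertwiner σ f) = f := by
    intro f
    rw [intertwiner_apply σ, intertwiner_act hσ', AlgEquiv.symm_apply_apply, intertwiner_apply]
    simp
  exact Function.LeftInverse.injective h

/-- Recursion computing the intertwiner on monomials: multiplication by `t` turns into `t +
h(d/dt)`. -/
theorem intertwiner_dualShear_X_pow_succ (h : k[X]) (j : ℕ) :
    intertwiner (dualShear h) (X ^ (j + 1)) =
      X * intertwiner (dualShear h) (X ^ j) +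
        aeval derivative h (intertwiner (dualShear h) (X ^ j)) := by
  have h1 := intertwiner_act (dualShear_d h) t (X ^ j)
  have h2 : act (pd h) = aeval (derivative : Module.End k k[X]) h := by
    rw [pd, ← aeval_algHom_apply]
    exact congrArg (fun D => aeval D h) (LinearMap.ext fun r => act_d (k := k) r)
  rw [act_t, ← pow_succ'] at h1
  rw [h1, dualShear_t, map_add, LinearMap.add_apply, act_t, h2]

end Automorphisms

/-! ### The ideals `{x : ∂x ∈ aA₁}` and elements of `H(k[X_n])`. -/

section PrimitiveIdeals

variable {k : Type*} [Field k]

/-- The right ideal of all `x` with `∂ x ∈ a A₁`. -/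
noncomputable def primIdeal (a : A₁ k) : RightIdeal (A₁ k) where
  carrier := {x | ∃ y, d * x = a * y}
  add_mem' := by
    rintro x y ⟨x', hx⟩ ⟨y', hy⟩
    exact ⟨x' + y', by rw [mul_add, hx, hy, mul_add]⟩
  zero_mem' := ⟨0, by simp⟩
  smul_mem' := by
    rintro c x ⟨x', hx⟩
    refine ⟨x' * c.unop, ?_⟩
    change d * (x * c.unop) = _
    rw [← mul_assoc, hx, mul_assoc]

theorem mem_primIdeal {a x : A₁ k} : x ∈ primIdeal a ↔ ∃ y, d * x = a * y := Iff.rfl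

theorem mapIdeal_primIdeal {σ : A₁ k ≃ₐ[k] A₁ k} (hσ : σ d = d) (a : A₁ k) :
    mapIdeal σ (primIdeal a) = primIdeal (σ a) := by
  ext x
  rw [mem_mapIdeal, mem_primIdeal]
  constructor
  · rintro ⟨x, ⟨y, hy⟩, rfl⟩
    exact ⟨σ y, by rw [← map_mul, ← hy, map_mul, hσ]⟩
  · rintro ⟨y, hy⟩
    refine ⟨σ.symm x, ⟨σ.symm y, σ.injective ?_⟩, by simp⟩
    rw [map_mul, map_mul, hσ]
    simpa using hy

theorem mapIdeal_eq_of_le {σ : A₁ k ≃ₐ[k] A₁ k} {I : RightIdeal (A₁ k)}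
    (h : mapIdeal σ I ≤ I) (h' : mapIdeal σ⁻¹ I ≤ I) : mapIdeal σ I = I := by
  refine le_antisymm h fun x hx => ⟨σ⁻¹ x, h' ⟨x, hx, rfl⟩, ?_⟩
  rw [← AlgEquiv.mul_apply, mul_inv_cancel, AlgEquiv.one_apply]

/-- The shear fixes `f` and changes `∂x` by `gx ∈ fA₁`. -/
theorem mapIdeal_shear_primIdeal {f g : k[X]} (h : f ∣ g) :
    mapIdeal (shear g) (primIdeal (pt f)) = primIdeal (pt f) := by
  have key : ∀ g : k[X], f ∣ g → mapIdeal (shear g) (primIdeal (pt f)) ≤ primIdeal (pt f) := by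
    rintro _ ⟨g, rfl⟩ _ ⟨x, ⟨y, hy⟩, rfl⟩
    refine ⟨shear (f * g) y - pt g * shear (f * g) x, ?_⟩
    have := congrArg (shear (f * g)) hy
    rw [map_mul, map_mul, shear_pt, shear_d, add_mul, map_mul] at this
    rw [mul_sub, ← this, mul_assoc]
    abel
  refine mapIdeal_eq_of_le (key g h) ?_
  rw [shear_inv]
  exact key _ (h.neg_right)

theorem mapIdeal_torus_primIdeal {c : k} (hc : c ≠ 0) (N : ℕ) :
    mapIdeal (torus hc) (primIdeal (t ^ N)) = primIdeal (t ^ N) := by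
  have key : ∀ {c : k} (hc : c ≠ 0), mapIdeal (torus hc) (primIdeal (t ^ N)) ≤
      primIdeal (t ^ N) := by
    rintro c hc _ ⟨x, ⟨y, hy⟩, rfl⟩
    -- The factor `c` undoes `∂ ↦ c⁻¹∂`, and `c ^ N` comes from `t^N ↦ c^N t^N`.
    refine ⟨(c * c ^ N) • torus hc y, ?_⟩
    have := congrArg (fun z => c • torus hc z) hy
    simp only [map_mul, map_pow, torus_d, torus_t, smul_mul_assoc, smul_smul, _root_.smul_pow] at this
    rw [mul_inv_cancel₀ hc, one_smul] at this
    rw [this, mul_smul_comm]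
  refine mapIdeal_eq_of_le (key hc) ?_
  exact key (inv_ne_zero hc)

/-- Multiplying two right ideals into a common one gives an isomorphism between them. -/
theorem Iso.of_mul_left {A : Type*} [Ring A] [NoZeroDivisors A] {I J : RightIdeal A} {a b : A}
    (ha : a ≠ 0) (hb : b ≠ 0) (h : ∀ x ∈ I, ∃ y ∈ J, a * x = b * y)
    (h' : ∀ y ∈ J, ∃ x ∈ I, a * x = b * y) : Iso I J := by
  choose f hf using fun x : I => h x.1 x.2
  have uniq : ∀ {y y' : A}, b * y = b * y' → y = y' := fun h => by
    have := mul_eq_zero.1 ((mul_sub b _ _).trans (sub_eq_zero.2 h))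
    exact sub_eq_zero.1 (this.resolve_left hb)
  refine ⟨LinearEquiv.ofBijective
    { toFun := fun x => ⟨f x, (hf x).1⟩, map_add' := ?_, map_smul' := ?_ } ⟨?_, ?_⟩⟩
  · intro x y
    refine Subtype.ext (uniq ?_)
    change b * f (x + y) = b * (f x + f y)
    rw [← (hf _).2, mul_add, ← (hf _).2, ← (hf _).2, Submodule.coe_add, mul_add]
  · intro c x
    refine Subtype.ext (uniq ?_)
    change b * f (c • x) = b * (f x * c.unop)
    rw [← (hf _).2, ← mul_assoc, ← (hf _).2, mul_assoc]
    rfl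
  · intro x y hxy
    have h1 : f x = f y := congrArg Subtype.val hxy
    have h2 : a * x.1 = a * y.1 := by rw [(hf x).2, (hf y).2, h1]
    have := mul_eq_zero.1 ((mul_sub a _ _).trans (sub_eq_zero.2 h2))
    exact Subtype.ext (sub_eq_zero.1 (this.resolve_left ha))
  · rintro ⟨y, hy⟩
    obtain ⟨x, hx, hxy⟩ := h' y hy
    exact ⟨⟨x, hx⟩, Subtype.ext (uniq ((hf ⟨x, hx⟩).2.symm.trans hxy))⟩

/-- The polynomials congruent to `(t + h(∂))^j` modulo `∂ A₁`. -/
noncomputable def tau (h : k[X]) : ℕ → k[X]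
  | 0 => 1
  | j + 1 => X * tau h j + aeval (-derivative : Module.End k k[X]) h (tau h j)

/-- Since `f∂ = ∂f - f'`, right multiplication by `∂` acts on polynomials modulo `∂A₁` as `-d/dt`.
-/
theorem exists_pt_mul_pd (h f : k[X]) :
    ∃ z : A₁ k, pt f * pd h = pt (aeval (-derivative : Module.End k k[X]) h f) + d * z := by
  induction h using Polynomial.induction_on generalizing f with
  | C a =>
    have h1 : (pd (C a) : A₁ k) = algebraMap k _ a := by
      rw [← Polynomial.algebraMap_eq, AlgHom.commutes]
    refine ⟨0, ?_⟩
    rw [mul_zero, add_zero, aeval_C, Module.algebraMap_end_apply, h1, ← Algebra.commutes,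
      ← Algebra.smul_def, map_smul]
  | add p q hp hq =>
    obtain ⟨z, hz⟩ := hp f
    obtain ⟨w, hw⟩ := hq f
    exact ⟨z + w, by rw [map_add, mul_add, hz, hw, map_add, LinearMap.add_apply, map_add, mul_add]; abel⟩
  | monomial n a h =>
    obtain ⟨z, hz⟩ := h (-derivative f)
    refine ⟨z + pt f * pd (C a * X ^ n), ?_⟩
    have h1 : (pd X : A₁ k) = d := aeval_X _
    have h2 : (pt (-derivative f) : A₁ k) + d * pt f = pt f * d := by
      rw [d_mul_pt, add_left_comm, ← map_add, neg_add_cancel, map_zero, add_zero]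
    rw [pow_succ, ← mul_assoc, map_mul, map_mul (aeval _), Module.End.mul_apply, aeval_X,
      LinearMap.neg_apply, mul_add, ← add_assoc, ← hz, h1, ← d_comm_pd, ← mul_assoc, ← mul_assoc,
      ← h2, add_mul]

theorem exists_dualShear_pow (h : k[X]) (N : ℕ) :
    ∃ z : A₁ k, dualShear h (t ^ N) = pt (tau h N) + d * z := by
  induction N with
  | zero => exact ⟨0, by simp [tau]⟩
  | succ N ih =>
    obtain ⟨z, hz⟩ := ih
    obtain ⟨w, hw⟩ := exists_pt_mul_pd h (tau h N)
    refine ⟨z * (t + pd h) + w, ?_⟩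
    rw [pow_succ, map_mul, hz, dualShear_t, tau, add_mul, mul_add (pt _), hw, map_add, map_mul, pt_X,
      t_comm_pt]
    simp only [mul_add, mul_assoc]; abel

theorem Iso.symm {A : Type*} [Ring A] {I J : RightIdeal A} (h : Iso I J) : Iso J I :=
  ⟨h.some.symm⟩

theorem Iso.trans {A : Type*} [Ring A] {I J K : RightIdeal A} (h : Iso I J) (h' : Iso J K) :
    Iso I K := ⟨h.some.trans h'.some⟩

theorem iso_of_eq {A : Type*} [Ring A] {I J : RightIdeal A} (h : I = J) : Iso I J :=
  h ▸ ⟨LinearEquiv.refl _ _⟩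

theorem mem_coordRing_iff' {n : ℕ} {f : k[X]} :
    f ∈ coordRing k n ↔ ∃ c : k, X ^ n ∣ f - C c := by
  rw [coordRing, Submodule.mem_sup]
  constructor
  · rintro ⟨y, hy, z, hz, rfl⟩
    obtain ⟨c, rfl⟩ := Submodule.mem_span_singleton.1 hy
    refine ⟨c, ?_⟩
    rw [smul_eq_C_mul, mul_one, add_sub_cancel_left]
    exact Ideal.mem_span_singleton.1 hz
  · rintro ⟨c, hc⟩
    exact ⟨C c, Submodule.mem_span_singleton.2 ⟨c, by rw [smul_eq_C_mul, mul_one]⟩, f - C c,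
      Ideal.mem_span_singleton.2 hc, by ring⟩

variable [CharZero k]

theorem d_ne_zero : (d : A₁ k) ≠ 0 := hasLead_d.ne_zero one_ne_zero

/-- Left multiplication by `∂` identifies `primIdeal a` with `∂A₁ ∩ aA₁`, and left division by `a`
identifies this with `{y : ay ∈ ∂A₁}`, which sees `a` only modulo `∂A₁`. -/
theorem primIdeal_iso {a b : A₁ k} (ha : a ≠ 0) (hb : b ≠ 0) (h : ∃ z, a = b + d * z) :
    Iso (primIdeal a) (primIdeal b) := by
  obtain ⟨z, rfl⟩ := h
  have key : ∀ a : A₁ k, a ≠ 0 → ∀ P : RightIdeal (A₁ k), (∀ y, y ∈ P ↔ ∃ x, a * y = d * x) →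
      Iso (primIdeal a) P := by
    intro a ha P hP
    refine Iso.of_mul_left d_ne_zero ha ?_ ?_
    · rintro x ⟨y, hy⟩
      exact ⟨y, (hP y).2 ⟨x, hy.symm⟩, hy⟩
    · intro y hy
      obtain ⟨x, hx⟩ := (hP y).1 hy
      exact ⟨x, ⟨y, hx.symm⟩, hx.symm⟩
  let P : RightIdeal (A₁ k) :=
    { carrier := {y | ∃ x, b * y = d * x}
      add_mem' := by
        rintro x y ⟨x', hx⟩ ⟨y', hy⟩
        exact ⟨x' + y', by rw [mul_add, hx, hy, mul_add]⟩
      zero_mem' := ⟨0, by simp⟩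
      smul_mem' := by
        rintro c x ⟨x', hx⟩
        refine ⟨x' * c.unop, ?_⟩
        change b * (x * c.unop) = _
        rw [← mul_assoc, hx, mul_assoc] }
  refine (key _ ha P fun y => ?_).trans (key b hb P fun y => Iff.rfl).symm
  change (∃ x, b * y = d * x) ↔ _
  constructor
  · rintro ⟨x, hx⟩
    exact ⟨x + z * y, by rw [add_mul, hx, mul_add, mul_assoc]⟩
  · rintro ⟨x, hx⟩
    exact ⟨x - z * y, by rw [mul_sub, ← hx, add_mul, mul_assoc]; abel⟩

theorem mem_coordRing_succ_iff {N : ℕ} {f : k[X]} :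
    f ∈ coordRing k (N + 1) ↔ X ^ N ∣ derivative f := by
  rw [mem_coordRing_iff']
  constructor
  · rintro ⟨c, g, hg⟩
    rw [sub_eq_iff_eq_add.1 hg, derivative_add, derivative_C, add_zero, derivative_mul,
      derivative_X_pow]
    refine dvd_add (Dvd.dvd.mul_right (Dvd.dvd.mul_left ?_ _) _) (Dvd.dvd.mul_right ?_ _)
    · simp
    · exact pow_dvd_pow _ (Nat.le_succ _)
  · intro h
    refine ⟨f.coeff 0, X_pow_dvd_iff.2 fun i hi => ?_⟩
    cases i with
    | zero => simp
    | succ i =>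
      have h1 := X_pow_dvd_iff.1 h i (by omega)
      rw [coeff_derivative] at h1
      have h2 : (i + 1 : k) ≠ 0 := by exact_mod_cast Nat.succ_ne_zero i
      rw [coeff_sub, coeff_C_succ, sub_zero]
      exact (mul_eq_zero.1 h1).resolve_right h2

/-- The subspace is cut out by `t^N ∣ f'`, so the condition on `x` is that all values of `∂x` are
divisible by `t^N`; `exists_eq_pt_mul` turns this into left divisibility. -/
theorem diffOps_coordRing (N : ℕ) :
    diffOps (coordRing k (N + 1)) = primIdeal (t ^ N) := by
  ext x
  change (∀ r, act x r ∈ coordRing k (N + 1)) ↔ ∃ y, d * x = t ^ N * y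
  simp only [mem_coordRing_succ_iff]
  rw [← pt_X, ← map_pow]
  constructor
  · intro h
    exact exists_eq_pt_mul fun r => by
      rw [map_mul, Module.End.mul_apply, act_d]; exact h r
  · rintro ⟨y, hy⟩ r
    have := congrArg (fun a => act a r) hy
    simp only [map_mul pt, map_mul act, Module.End.mul_apply, act_d, act_pt] at this
    exact ⟨_, this⟩

theorem coordRing_zero_eq : coordRing k 0 = coordRing k 1 := by
  ext f
  rw [mem_coordRing_succ_iff (N := 0), mem_coordRing_iff']
  simp

theorem shear_mem_stafford {N : ℕ} {g : k[X]} (h : X ^ N ∣ g) :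
    shear g ∈ stafford (diffOps (coordRing k (N + 1))) := by
  refine iso_of_eq ?_
  rw [diffOps_coordRing, ← pt_X, ← map_pow, mapIdeal_shear_primIdeal h]

theorem torus_mem_stafford {c : k} (hc : c ≠ 0) (N : ℕ) :
    torus hc ∈ stafford (diffOps (coordRing k (N + 1))) := by
  refine iso_of_eq ?_
  rw [diffOps_coordRing, mapIdeal_torus_primIdeal hc]

/-- The dual shear moves the ideal to one isomorphic to `primIdeal (pt (tau h N))`, which is
preserved by `shear g`; moving back gives the conjugate. -/
theorem conj_shear_mem_stafford {N : ℕ} {h g : k[X]} (h0 : tau h N ≠ 0) (hg : tau h N ∣ g) :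
    (dualShear h)⁻¹ * shear g * dualShear h ∈ stafford (diffOps (coordRing k (N + 1))) := by
  have ht : (t : A₁ k) ^ N ≠ 0 := by
    rw [← pt_X, ← map_pow]
    exact fun h => pow_ne_zero N X_ne_zero (pt_injective (h.trans (map_zero _).symm))
  have h1 : Iso (mapIdeal (dualShear h) (diffOps (coordRing k (N + 1))))
      (primIdeal (pt (tau h N))) := by
    rw [diffOps_coordRing, mapIdeal_primIdeal (dualShear_d h)]
    refine primIdeal_iso ?_ ?_ (exists_dualShear_pow h N)
    · exact fun h' => ht ((dualShear h).injective (h'.trans (map_zero _).symm))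
    · exact fun h => h0 (pt_injective (h.trans (map_zero _).symm))
  change Iso (mapIdeal _ _) _
  rw [mapIdeal_mul, mapIdeal_mul]
  have h2 := h1.map (shear g)
  rw [mapIdeal_shear_primIdeal hg] at h2
  have h3 := (h2.trans h1.symm).map (dualShear h)⁻¹
  rwa [← mapIdeal_mul (dualShear h)⁻¹ (dualShear h), inv_mul_cancel, mapIdeal_one] at h3

end PrimitiveIdeals

/-! ### Isomorphic right ideals with the same trace on `k[t]` coincide. -/

section Rigidity

variable {k : Type*} [Field k]

theorem rightIdeal_mul_mem {A : Type*} [Ring A] {I : RightIdeal A} {x : A} (hx : x ∈ I) (z : A) :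
    x * z ∈ I :=
  I.smul_mem (MulOpposite.op z) hx

theorem coe_map_mul {A : Type*} [Ring A] {I J : RightIdeal A} (φ : I →ₗ[Aᵐᵒᵖ] J) (x : I) (z : A)
    (h : x.1 * z ∈ I) : (φ ⟨x.1 * z, h⟩ : A) = φ x * z :=
  congrArg Subtype.val (φ.map_smul (MulOpposite.op z) x)

theorem exists_d_pow_mul_pt_pow (c : k[X]) (m l : ℕ) :
    ∃ w : A₁ k, d ^ m * pt (c ^ (m + l)) = pt (c ^ l) * w := by
  induction m generalizing l with
  | zero => exact ⟨1, by simp⟩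
  | succ m ih =>
    obtain ⟨w, hw⟩ := ih (l + 1)
    refine ⟨pt c * d * w + pt (((l + 1 : ℕ) : k[X]) * derivative c) * w, ?_⟩
    have h1 : derivative (c ^ (l + 1)) = c ^ l * (((l + 1 : ℕ) : k[X]) * derivative c) := by
      rw [derivative_pow_succ]; push_cast; ring_nf
      simp; ring
    rw [show m + 1 + l = m + (l + 1) by omega, pow_succ' d, mul_assoc, hw, ← mul_assoc, d_mul_pt, h1,
      map_mul pt (c ^ l), pow_succ, map_mul]
    simp only [add_mul, mul_add, mul_assoc]

/-- Each `∂` moved past a power of `c` costs one factor `c`. This Ore condition lets a right linear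
map be computed from its value at `c`. -/
theorem exists_mul_pt_pow {m : ℕ} {a : A₁ k} (ha : a ∈ Fil (k := k) m) (c : k[X]) :
    ∃ z, a * pt (c ^ m) = pt c * z := by
  induction m generalizing a with
  | zero => exact ⟨0, by simp [mem_Fil_zero.1 ha]⟩
  | succ m ih =>
    obtain ⟨α, h⟩ := mem_Fil_succ.1 ha
    obtain ⟨z, hz⟩ := ih h
    obtain ⟨w, hw⟩ := exists_d_pow_mul_pt_pow c m 1
    refine ⟨z * pt c + pt α * w, ?_⟩
    rw [pow_one] at hw
    have h1 : a * pt (c ^ (m + 1)) = (a - pt α * d ^ m) * pt (c ^ m) * pt c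
        + pt α * (d ^ m * pt (c ^ (m + 1))) := by
      rw [mul_assoc _ (pt (c ^ m)), ← map_mul, ← pow_succ, sub_mul, mul_assoc]; abel
    rw [h1, hz, hw, mul_add, mul_assoc, ← mul_assoc (pt α), pt_comm α, mul_assoc]

theorem pt_ne_zero {f : k[X]} (h : f ≠ 0) : (pt f : A₁ k) ≠ 0 :=
  fun h' => h (pt_injective (h'.trans (map_zero _).symm))

variable [CharZero k]

theorem weyl_mul_right_cancel {a b c : A₁ k} (hc : c ≠ 0) (h : a * c = b * c) : a = b := by
  by_contra hab
  refine weyl_mul_ne_zero (a := a - b) (fun h' => hab (sub_eq_zero.1 h')) hc ?_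
  rw [sub_mul, h, sub_self]

/-- An isomorphism of right ideals with the same nonzero intersection with `k[t]` is a
multiplication by a scalar. -/
theorem Iso.le_of_inter {I J : RightIdeal (A₁ k)} {D : Ideal k[X]} (hD : D ≠ ⊥)
    (hI : ∀ f, pt f ∈ I ↔ f ∈ D) (hJ : ∀ f, pt f ∈ J ↔ f ∈ D) (h : Iso I J) : I ≤ J := by
  obtain ⟨φ⟩ := h
  obtain ⟨c, rfl⟩ := (IsPrincipalIdealRing.principal D).principal
  have hc : c ≠ 0 := by rintro rfl; simp at hD
  have hcI : pt c ∈ I := (hI c).2 (Submodule.mem_span_singleton_self c)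
  have hcJ : pt c ∈ J := (hJ c).2 (Submodule.mem_span_singleton_self c)
  have φ_ne : ∀ x : I, x.1 ≠ 0 → (φ x).1 ≠ 0 := fun x hx h0 => hx (by
    have : φ x = 0 := Subtype.ext h0
    rw [LinearEquiv.map_eq_zero_iff] at this
    rw [this]; rfl)
  obtain ⟨s, γ, hγ, hs⟩ := exists_hasLead' (φ_ne ⟨pt c, hcI⟩ (pt_ne_zero hc))
  -- From `x c^(j+1) = c z` follows `φ(x) c^(j+1) = φ(c) z`.
  have cross : ∀ x : I, ∀ j, x.1 ∈ Fil (k := k) (j + 1) → ∃ z, x.1 * pt (c ^ (j + 1)) = pt c * z ∧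
      (φ x).1 * pt (c ^ (j + 1)) = φ ⟨pt c, hcI⟩ * z := by
    intro x j hx
    obtain ⟨z, hz⟩ := exists_mul_pt_pow hx c
    refine ⟨z, hz, ?_⟩
    have h1 := coe_map_mul φ.toLinearMap x _ (rightIdeal_mul_mem x.2 (pt (c ^ (j + 1))))
    have h2 := coe_map_mul φ.toLinearMap ⟨pt c, hcI⟩ z (rightIdeal_mul_mem hcI _)
    refine h1.symm.trans (Eq.trans ?_ h2)
    exact congrArg (fun y : I => (φ y).1) (Subtype.ext hz)
  -- Comparing orders in `cross`: `φ` raises every order by `s`, the order of `φ(c)`.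
  have ord : ∀ x : I, ∀ j α, α ≠ 0 → HasLead x.1 j α → ∀ l β, β ≠ 0 → HasLead (φ x).1 l β →
      l = s + j := by
    intro x j α hα hx l β hβ hl
    obtain ⟨z, hz, hz'⟩ := cross x j hx.mem
    have hcj : c ^ (j + 1) ≠ 0 := pow_ne_zero _ hc
    have hz0 : z ≠ 0 := by
      rintro rfl
      rw [mul_zero] at hz
      exact weyl_mul_ne_zero (hx.ne_zero hα) (pt_ne_zero hcj) hz
    obtain ⟨i, ζ, hζ, hi⟩ := exists_hasLead' hz0
    have e1 := hx.mul (hasLead_pt (c ^ (j + 1)))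
    rw [hz] at e1
    have e2 := e1.eq_of_ne ((hasLead_pt c).mul hi) (mul_ne_zero hα hcj) (mul_ne_zero hc hζ)
    have e3 := hl.mul (hasLead_pt (c ^ (j + 1)))
    rw [hz'] at e3
    have e4 := e3.eq_of_ne (hs.mul hi) (mul_ne_zero hβ hcj) (mul_ne_zero hγ hζ)
    omega
  -- The preimage of `c` has order `j` with `s + j = 0`, so `φ(c)` and this preimage are both
  -- polynomials in the common trace `D`.
  obtain ⟨x, hx⟩ := φ.surjective ⟨pt c, hcJ⟩
  have hx0 : x.1 ≠ 0 := by
    intro h0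
    have : x = 0 := Subtype.ext h0
    rw [this, map_zero] at hx
    exact pt_ne_zero hc (congrArg Subtype.val hx).symm
  obtain ⟨j, α, hα, hj⟩ := exists_hasLead' hx0
  have hord := ord x j α hα hj 0 c hc (by rw [hx]; exact hasLead_pt c)
  obtain rfl : s = 0 := by omega
  obtain rfl : j = 0 := by omega
  have order_zero : ∀ {a : A₁ k} {β}, HasLead a 0 β → a = pt β := by
    intro a β h
    rw [HasLead, mem_Fil_zero, pow_zero, mul_one, sub_eq_zero] at h
    exact h
  have hxα := order_zero hj
  have hφγ := order_zero hs
  have hαD : α ∈ Submodule.span k[X] {c} := (hI α).1 (hxα ▸ x.2)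
  have hγD : γ ∈ Submodule.span k[X] {c} := (hJ γ).1 (hφγ ▸ (φ ⟨pt c, hcI⟩).2)
  obtain ⟨a, ha⟩ := Submodule.mem_span_singleton.1 hαD
  obtain ⟨e, he⟩ := Submodule.mem_span_singleton.1 hγD
  -- Here `φ(c) = ec` and `φ(ac) = c`, so `e` is a nonzero scalar, and `cross` shows that `φ` is
  -- multiplication by it.
  have hae : e * a = 1 := by
    have h1 := coe_map_mul φ.toLinearMap ⟨pt c, hcI⟩ (pt a) (rightIdeal_mul_mem hcI _)
    have h2 : (⟨pt c * pt a, rightIdeal_mul_mem hcI _⟩ : I) = x := Subtype.ext (by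
      rw [hxα, ← ha, smul_eq_mul, mul_comm, map_mul])
    have h3 : (φ x : A₁ k) = φ ⟨pt c, hcI⟩ * pt a := by rw [← h2]; exact h1
    rw [hx, hφγ, ← map_mul] at h3
    have h4 := pt_injective h3
    rw [← he, smul_eq_mul] at h4
    refine mul_left_cancel₀ hc ?_
    rw [mul_one]; conv_rhs => rw [h4]
    ring
  intro y hy
  by_cases hy0 : y = 0
  · rw [hy0]; exact zero_mem _
  obtain ⟨j, β, hβ, hj'⟩ := exists_hasLead' hy0
  obtain ⟨z, hz, hz'⟩ := cross ⟨y, hy⟩ j hj'.mem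
  obtain ⟨r, hr, hre⟩ := Polynomial.isUnit_iff.1 (IsUnit.of_mul_eq_one (a := e) a hae)
  have h1 : (φ ⟨y, hy⟩ : A₁ k) = r • y := by
    refine weyl_mul_right_cancel (pt_ne_zero (pow_ne_zero (j + 1) hc)) ?_
    rw [hz', hφγ, ← he, smul_eq_mul, ← hre, smul_mul_assoc, hz, map_mul, mul_assoc,
      ← Polynomial.algebraMap_eq, AlgHom.commutes, ← Algebra.smul_def]
  have h2 : y = (φ ⟨y, hy⟩ : A₁ k) * algebraMap k _ r⁻¹ := by
    rw [← Algebra.commutes, ← Algebra.smul_def, h1, smul_smul, inv_mul_cancel₀ hr.ne_zero, one_smul]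
  rw [h2]
  exact rightIdeal_mul_mem (φ ⟨y, hy⟩).2 _

theorem Iso.eq_of_inter {I J : RightIdeal (A₁ k)} {D : Ideal k[X]} (hD : D ≠ ⊥)
    (hI : ∀ f, pt f ∈ I ↔ f ∈ D) (hJ : ∀ f, pt f ∈ J ↔ f ∈ D) (h : Iso I J) : I = J :=
  le_antisymm (h.le_of_inter hD hI hJ) (h.symm.le_of_inter hD hJ hI)

end Rigidity

/-! ### Reduction to a monomial subspace with gap set `G`. -/

section Subspaces

variable {k : Type*} [Field k]

theorem mem_diffOps {V : Submodule k k[X]} {a : A₁ k} : a ∈ diffOps V ↔ ∀ r, act a r ∈ V := Iff.rfl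

theorem pt_mem_diffOps {V : Submodule k k[X]} {f : k[X]} :
    pt f ∈ diffOps V ↔ f ∈ conductor V := by
  rw [mem_diffOps]
  simp only [act_pt]
  rfl

/-- All of `b²R` lies in `O(b)`, hence in `S(V)`, so `b²v` lies in the conductor for each `v ∈ V`.
-/
theorem IsPrimaryDecomposable.conductor_ne_bot {V : Submodule k k[X]}
    (hV : IsPrimaryDecomposable V) : conductor V ≠ ⊥ := by
  obtain ⟨h0, b, hb, hbV⟩ := hV
  obtain ⟨v, hv, hv0⟩ := Submodule.exists_mem_ne_zero_of_ne_bot h0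
  have : b ^ 2 * v ∈ conductor V := by
    intro r
    have h1 : b ^ 2 * r ∈ ringO b := by
      change b ∣ derivative (b ^ 2 * r)
      rw [derivative_mul, derivative_sq]
      refine dvd_add ?_ ?_
      · exact ⟨C 2 * derivative b * r, by ring⟩
      · exact ⟨b * derivative r, by ring⟩
    have := hbV h1 v hv
    rwa [mul_right_comm]
  intro h
  rw [h] at this
  exact mul_ne_zero (pow_ne_zero 2 hb) hv0 ((Submodule.mem_bot _).1 this)

theorem exists_pt_mul_d_pow (b : k[X]) (m : ℕ) :
    ∃ w : A₁ k, pt b * d ^ m = pt ((-derivative : Module.End k k[X])^[m] b) + d * w := by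
  obtain ⟨z, hz⟩ := exists_pt_mul_pd (X ^ m) b
  refine ⟨z, ?_⟩
  have h1 : (pd (X ^ m) : A₁ k) = d ^ m := by rw [map_pow]; congr 1; exact aeval_X _
  rw [h1, map_pow, aeval_X, Module.End.pow_apply] at hz
  exact hz

/-- Coefficients of a polynomial function with values in a subspace lie in that subspace. -/
theorem mem_of_forall_sum_smul_mem [Infinite k] {M : Type*} [AddCommGroup M] [Module k M]
    {W : Submodule k M} {m : ℕ} {y : ℕ → M}
    (h : ∀ c : k, c ≠ 0 → ∑ i ∈ Finset.range m, c ^ i • y i ∈ W) {i : ℕ} (hi : i < m) : y i ∈ W := by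
  by_contra hy
  -- A functional killing `W` but not `y i` yields a nonzero polynomial in `c` vanishing at every `c
  -- ≠ 0`.
  obtain ⟨f, hf, hW⟩ := Submodule.exists_le_ker_of_notMem hy
  let Q : k[X] := ∑ i ∈ Finset.range m, C (f (y i)) * X ^ i
  have hQ : Q = 0 := by
    refine Polynomial.eq_zero_of_infinite_isRoot Q (Set.Infinite.mono (s := {0}ᶜ) ?_
      (Set.finite_singleton 0).infinite_compl)
    intro c hc
    have h1 : f (∑ i ∈ Finset.range m, c ^ i • y i) = 0 := hW (h c hc)
    change Q.eval c = 0
    rw [eval_finsetSum, ← h1, map_sum]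
    refine Finset.sum_congr rfl fun i _ => ?_
    rw [eval_C_mul, eval_pow, eval_X, map_smul, smul_eq_mul, mul_comm]
  have h2 : Q.coeff i = f (y i) := by
    simp only [Q, finsetSum_coeff, coeff_C_mul_X_pow]
    rw [Finset.sum_ite_eq, if_pos (Finset.mem_range.2 hi)]
  rw [hQ, coeff_zero] at h2
  exact hf h2.symm

/-- Formally the shear by `c p'` is `x ↦ exp(-cp) x exp(cp)`: polynomial in `c`, with linear term
the commutator `[x, p]`. -/
theorem exists_shear_expansion (p : k[X]) (x : A₁ k) : ∃ P : Polynomial (A₁ k),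
    (∀ c : k, P.eval (algebraMap k _ c) = shear (C c * derivative p) x) ∧ P.coeff 0 = x ∧
      P.coeff 1 = x * pt p - pt p * x := by
  induction x using weyl_induction with
  | hs r => exact ⟨C (algebraMap k _ r), fun c => by rw [eval_C, AlgEquiv.commutes], by simp, by
      rw [Algebra.commutes, sub_self, coeff_C_succ]⟩
  | ht => exact ⟨C t, fun c => by rw [eval_C, shear_t], by simp, by
      rw [t_comm_pt, sub_self, coeff_C_succ]⟩
  | hd =>
    refine ⟨C d + C (pt (derivative p)) * X, fun c => ?_, by simp, ?_⟩
    · rw [eval_add, eval_C, eval_C_mul, eval_X, shear_d, map_mul, ← Polynomial.algebraMap_eq,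
        AlgHom.commutes, Algebra.commutes]
    · rw [coeff_add, coeff_C_succ, coeff_C_mul_X, if_pos rfl, d_mul_pt]; abel
  | hmul a b ha hb =>
    obtain ⟨P, h1, h2, h3⟩ := ha
    obtain ⟨Q, h4, h5, h6⟩ := hb
    refine ⟨P * Q, fun c => ?_, by rw [mul_coeff_zero, h2, h5], ?_⟩
    · rw [map_mul, ← h1, ← h4]
      exact eval₂_mul_noncomm _ _ fun i => (Algebra.commutes c _).symm
    · rw [mul_coeff_one, h2, h3, h5, h6]
      simp only [mul_sub, sub_mul, mul_assoc]; abel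
  | hadd a b ha hb =>
    obtain ⟨P, h1, h2, h3⟩ := ha
    obtain ⟨Q, h4, h5, h6⟩ := hb
    refine ⟨P + Q, fun c => ?_, by rw [coeff_add, h2, h5], ?_⟩
    · rw [map_add, ← h1, ← h4, eval_add]
    · rw [coeff_add, h3, h6]
      simp only [mul_add, add_mul]; abel

theorem iterate_neg_derivative (m : ℕ) (b : k[X]) :
    (-derivative : Module.End k k[X])^[m] b = (-1) ^ m * derivative^[m] b := by
  induction m with
  | zero => simp
  | succ m ih =>
    rw [Function.iterate_succ_apply', ih, Function.iterate_succ_apply', LinearMap.neg_apply,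
      derivative_mul]
    have : derivative ((-1 : k[X]) ^ m) = 0 := by
      rw [derivative_pow]; simp
    rw [this]; ring

variable [CharZero k]

theorem iterate_neg_derivative_natDegree {b : k[X]} (hb : b ≠ 0) :
    ∃ c : k, c ≠ 0 ∧ (-derivative : Module.End k k[X])^[b.natDegree] b = C c := by
  refine ⟨(-1) ^ b.natDegree * (b.natDegree.factorial * b.leadingCoeff), ?_, ?_⟩
  · exact mul_ne_zero (pow_ne_zero _ (neg_ne_zero.2 one_ne_zero))
      (mul_ne_zero (Nat.cast_ne_zero.2 (Nat.factorial_ne_zero _)) (leadingCoeff_ne_zero.2 hb))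
  · rw [iterate_neg_derivative]
    have h2 : derivative^[b.natDegree] b = C (b.natDegree.factorial * b.leadingCoeff) := by
      have h3 : (derivative^[b.natDegree] b).natDegree = 0 := by
        have := natDegree_iterate_derivative b b.natDegree
        omega
      rw [eq_C_of_natDegree_eq_zero h3, coeff_iterate_derivative]
      simp [Nat.descFactorial_self]
    rw [h2]; simp

/-- Every element of a primary decomposable subspace is a value of an operator into it. -/
theorem IsPrimaryDecomposable.exists_act_one {V : Submodule k k[X]}
    (hV : IsPrimaryDecomposable V) {v : k[X]} (hv : v ∈ V) : ∃ x ∈ diffOps V, act x 1 = v := by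
  obtain ⟨-, b, hb, hbV⟩ := hV
  obtain ⟨c, hc, hcb⟩ := iterate_neg_derivative_natDegree hb
  obtain ⟨w, hw⟩ := exists_pt_mul_d_pow b b.natDegree
  rw [hcb, ← Polynomial.algebraMap_eq, AlgHom.commutes] at hw
  -- With `b∂^m = c + ∂w`, where `m = deg b`, one gets `∂(1 + c⁻¹w∂) = c⁻¹b∂^(m+1)`. So this
  -- operator takes values in `O(b)`, and it sends `1` to `1`.
  have hy : ∀ r, act (1 + (c⁻¹ • w) * d) r ∈ ringO b := by
    intro r
    change b ∣ derivative _
    have h1 : d * (1 + (c⁻¹ • w) * d) = pt b * (c⁻¹ • (d ^ b.natDegree * d)) := by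
      rw [mul_smul_comm, ← mul_assoc, hw, mul_add, mul_one, smul_mul_assoc, mul_smul_comm, add_mul,
        smul_add, ← Algebra.smul_def, smul_smul, inv_mul_cancel₀ hc, one_smul, mul_assoc]
    rw [← act_d, ← Module.End.mul_apply, ← map_mul, h1, map_mul, Module.End.mul_apply, act_pt]
    exact dvd_mul_right _ _
  refine ⟨pt v * (1 + (c⁻¹ • w) * d), fun r => ?_, ?_⟩
  · rw [map_mul, Module.End.mul_apply, act_pt, mul_comm]
    exact hbV (hy r) v hv
  · rw [map_mul, Module.End.mul_apply, act_pt, map_add, map_mul, LinearMap.add_apply,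
      Module.End.mul_apply, act_d]
    simp

/-- A shear fixes `k[t]` pointwise, so rigidity upgrades the isomorphism to an equality. -/
theorem mapIdeal_shear_diffOps {V : Submodule k k[X]} (hV : conductor V ≠ ⊥) {g : k[X]}
    (h : shear g ∈ stafford (diffOps V)) : mapIdeal (shear g) (diffOps V) = diffOps V := by
  refine Iso.eq_of_inter hV (fun f => ?_) (fun f => pt_mem_diffOps) h
  rw [← pt_mem_diffOps, mem_mapIdeal]
  constructor
  · rintro ⟨a, ha, hf⟩
    have : a = pt f := (shear g).injective (hf.trans (shear_pt g f).symm)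
    rwa [← this]
  · exact fun h => ⟨pt f, h, shear_pt g f⟩

/-- Write `v = x(1)` with `x ∈ D(R, V)`. The linear term in `c` of the sheared operator, evaluated
at `1`, is `x(p) - pv`; it lies in `V`, and so does `x(p)`. -/
theorem mem_stabRing_of_shear {V : Submodule k k[X]} (hV : IsPrimaryDecomposable V) {p : k[X]}
    (h : ∀ c : k, shear (C c * derivative p) ∈ stafford (diffOps V)) : p ∈ stabRing V := by
  intro v hv
  obtain ⟨x, hx, rfl⟩ := hV.exists_act_one hv
  obtain ⟨P, h1, h2, h3⟩ := exists_shear_expansion p x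
  have h4 : act (P.coeff 1) 1 ∈ V := by
    refine mem_of_forall_sum_smul_mem (m := P.natDegree + 1 + 1) (y := fun i => act (P.coeff i) 1)
      (fun c _ => ?_) (by omega)
    have h5 : shear (C c * derivative p) x ∈ diffOps V := by
      rw [← mapIdeal_shear_diffOps hV.conductor_ne_bot (h c)]
      exact ⟨x, hx, rfl⟩
    have h6 := h5 1
    rw [← h1, eval_eq_sum_range' (n := P.natDegree + 1 + 1) (by omega), map_sum,
      LinearMap.sum_apply] at h6
    convert h6 using 2 with i
    rw [← map_pow, ← Algebra.commutes, ← Algebra.smul_def, map_smul, LinearMap.smul_apply]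
  rw [h3, map_sub, map_mul, map_mul, LinearMap.sub_apply, Module.End.mul_apply, Module.End.mul_apply,
    act_pt, act_pt, mul_one] at h4
  have := V.sub_mem (hx p) h4
  rwa [sub_sub_cancel] at this

/-- Multiples of `t^(N+1)` have derivative divisible by `t^N`, hence lie in `S(V)`; irreducibility
says that `V` generates the unit ideal. -/
theorem X_pow_mem_conductor {V : Submodule k k[X]} (hV : IsPrimaryDecomposable V)
    (hirr : IsIrreducible V) {N : ℕ}
    (hH : stafford (diffOps (coordRing k (N + 1))) ≤ stafford (diffOps V)) :
    X ^ (N + 1) ∈ conductor V := by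
  have h1 : ∀ f, X ^ (N + 1) * f ∈ stabRing V := by
    intro f
    refine mem_stabRing_of_shear hV fun c => hH (shear_mem_stafford (Dvd.dvd.mul_left ?_ _))
    rw [derivative_mul, derivative_X_pow]
    refine dvd_add (Dvd.dvd.mul_right (Dvd.dvd.mul_left ?_ _) _) (Dvd.dvd.mul_right ?_ _)
    · simp
    · exact pow_dvd_pow _ (Nat.le_succ _)
  have h2 : Ideal.span (V : Set k[X]) = ⊤ := by
    by_contra h
    exact hirr _ h Ideal.subset_span
  have h3 : ∀ w ∈ Ideal.span (V : Set k[X]), ∀ f, X ^ (N + 1) * f * w ∈ V := by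
    intro w hw
    induction hw using Submodule.span_induction with
    | mem v hv => exact fun f => h1 f v hv
    | zero => intro f; rw [mul_zero]; exact zero_mem _
    | add v w _ _ hv hw => intro f; rw [mul_add]; exact add_mem (hv f) (hw f)
    | smul r v _ hv => intro f; rw [smul_eq_mul, ← mul_assoc, mul_assoc (X ^ (N + 1))]; exact hv _
  intro f
  have := h3 1 (by rw [h2]; trivial) f
  rwa [mul_one] at this

/-- The conductor contains a power of `t`, so it is generated by one and is stable under `t ↦ ct`;
thus rigidity applies to the torus as well. -/
theorem comp_mem_of_torus {V : Submodule k k[X]} (hV : IsPrimaryDecomposable V) {n : ℕ}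
    (hn : X ^ n ∈ conductor V) {c : k} (hc : c ≠ 0) (h : torus hc ∈ stafford (diffOps V))
    {v : k[X]} (hv : v ∈ V) : v.comp (C c * X) ∈ V := by
  obtain ⟨q, hq⟩ := (IsPrincipalIdealRing.principal (conductor V)).principal
  obtain ⟨m, hm⟩ : ∃ m, conductor V = Ideal.span {X ^ m} := by
    have : q ∣ X ^ n := by
      rw [hq] at hn
      exact Ideal.mem_span_singleton.1 hn
    obtain ⟨m, _, hm⟩ := (dvd_prime_pow prime_X n).1 this
    exact ⟨m, hq.trans (Ideal.span_singleton_eq_span_singleton.2 hm)⟩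
  have hdvd : ∀ {e : k} {f : k[X]}, X ^ m ∣ f → X ^ m ∣ f.comp (C e * X) := by
    rintro e _ ⟨f, rfl⟩
    rw [mul_comp, pow_comp, X_comp, mul_pow]
    exact Dvd.dvd.mul_right (dvd_mul_left _ _) _
  have hcomp : ∀ (e : k) (_ : e ≠ 0) (f : k[X]), (f.comp (C e⁻¹ * X)).comp (C e * X) = f := by
    intro e he f
    rw [comp_assoc, mul_comp, C_comp, X_comp, ← mul_assoc, ← C_mul, inv_mul_cancel₀ he, C_1, one_mul,
      comp_X]
  have htorus : ∀ f : k[X], torus hc (pt (f.comp (C c⁻¹ * X))) = pt f := by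
    intro f
    refine act_injective (LinearMap.ext fun r => ?_)
    have h1 := act_torus hc (pt (f.comp (C c⁻¹ * X))) (r.comp (C c⁻¹ * X))
    rw [hcomp c hc, act_pt, mul_comp, hcomp c hc, hcomp c hc] at h1
    rw [h1, act_pt]
  have heq : mapIdeal (torus hc) (diffOps V) = diffOps V := by
    refine Iso.eq_of_inter hV.conductor_ne_bot (fun f => ?_) (fun f => pt_mem_diffOps) h
    rw [hm, Ideal.mem_span_singleton, mem_mapIdeal]
    constructor
    · rintro ⟨a, ha, hf⟩
      have : a = pt (f.comp (C c⁻¹ * X)) := (torus hc).injective (hf.trans (htorus f).symm)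
      rw [this, pt_mem_diffOps, hm, Ideal.mem_span_singleton] at ha
      have := hdvd (e := c) ha
      rwa [hcomp c hc] at this
    · intro h
      refine ⟨_, ?_, htorus f⟩
      rw [pt_mem_diffOps, hm, Ideal.mem_span_singleton]
      exact hdvd h
  obtain ⟨x, hx, rfl⟩ := hV.exists_act_one hv
  rw [← act_torus hc x 1, one_comp]
  have : torus hc x ∈ diffOps V := by
    rw [← heq]; exact ⟨x, hx, rfl⟩
  exact this 1

/-- Torus stability splits elements of `V` into monomials. The conductor supplies the exponents
above `N`, and irreducibility supplies `1`, since otherwise `V ⊆ tR`. -/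
theorem exists_gaps {V : Submodule k k[X]} (hV : IsPrimaryDecomposable V)
    (hirr : IsIrreducible V) {N : ℕ}
    (hH : stafford (diffOps (coordRing k (N + 1))) ≤ stafford (diffOps V)) :
    ∃ G ⊆ Finset.Icc 1 N, ∀ f, f ∈ V ↔ ∀ i ∈ G, f.coeff i = 0 := by
  classical
  have hn := X_pow_mem_conductor hV hirr hH
  have hmon : ∀ v ∈ V, ∀ i, monomial i (v.coeff i) ∈ V := by
    intro v hv i
    by_cases hi : i < v.natDegree + 1
    · refine mem_of_forall_sum_smul_mem (y := fun i => monomial i (v.coeff i)) (fun c hc => ?_) hi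
      have h1 := comp_mem_of_torus hV hn hc (hH (torus_mem_stafford hc N)) hv
      convert h1 using 1
      rw [comp, eval₂_eq_sum_range]
      refine Finset.sum_congr rfl fun i _ => ?_
      rw [mul_pow, smul_monomial, ← C_mul_X_pow_eq_monomial, smul_eq_mul, C_mul, C_pow]
      ring
    · rw [coeff_eq_zero_of_natDegree_lt (by omega), map_zero]
      exact zero_mem _
  have hX : ∀ v ∈ V, ∀ i, v.coeff i ≠ 0 → X ^ i ∈ V := by
    intro v hv i hi
    have := V.smul_mem (v.coeff i)⁻¹ (hmon v hv i)
    rwa [smul_monomial, smul_eq_mul, inv_mul_cancel₀ hi, monomial_one_right_eq_X_pow] at this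
  have hlarge : ∀ i, N < i → X ^ i ∈ V := by
    intro i hi
    have := hn (X ^ (i - (N + 1)))
    rwa [← pow_add, Nat.add_sub_cancel' hi] at this
  have hzero : X ^ 0 ∈ V := by
    by_contra h
    refine hirr (Ideal.span {X}) ?_ fun v hv => ?_
    · rw [Ne, Ideal.span_singleton_eq_top]
      exact not_isUnit_X
    · refine Ideal.mem_span_singleton.2 (X_dvd_iff.2 ?_)
      by_contra h0
      exact h (hX v hv 0 h0)
  refine ⟨(Finset.Icc 1 N).filter fun i => X ^ i ∉ V, Finset.filter_subset _ _, fun f => ?_⟩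
  constructor
  · intro hf i hi
    by_contra h0
    exact (Finset.mem_filter.1 hi).2 (hX f hf i h0)
  · intro hf
    rw [f.as_sum_support]
    refine Submodule.sum_mem _ fun i hi => ?_
    have h1 : X ^ i ∈ V := by
      by_contra h
      refine mem_support_iff.1 hi (hf i (Finset.mem_filter.2 ⟨Finset.mem_Icc.2 ⟨?_, ?_⟩, h⟩))
      · by_contra h0
        obtain rfl : i = 0 := by omega
        exact h hzero
      · by_contra h0
        exact h (hlarge i (by omega))
    rw [← C_mul_X_pow_eq_monomial, ← smul_eq_C_mul]
    exact V.smul_mem _ h1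

end Subspaces

/-! ### The Euler operator `t∂` and division by `∏ (t∂ - g)`. -/

section Euler

variable {k : Type*} [Field k]

theorem coeff_act_euler (U f : k[X]) (j : ℕ) :
    (act (aeval (t * d : A₁ k) U) f).coeff j = U.eval (j : k) * f.coeff j := by
  induction U using Polynomial.induction_on generalizing f with
  | C a => rw [aeval_C, AlgHom.commutes, Module.algebraMap_end_apply, eval_C, coeff_smul, smul_eq_mul]
  | add p q hp hq => rw [map_add, map_add, LinearMap.add_apply, coeff_add, hp, hq, eval_add, add_mul]
  | monomial n a h =>
    rw [pow_succ, ← mul_assoc, map_mul, map_mul, Module.End.mul_apply, h, aeval_X, map_mul,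
      Module.End.mul_apply, act_t, act_d, eval_mul_X, mul_assoc]
    congr 1
    cases j with
    | zero => simp
    | succ j => rw [coeff_X_mul, coeff_derivative, mul_comm]; push_cast; rfl

/-- Operators written in terms of the Euler operator `t ∂`. -/
noncomputable def eulerForm (P : k[X][X]) : A₁ k := eval₂ (pt : k[X] →ₐ[k] A₁ k).toRingHom (t * d) P

theorem eulerForm_add (P Q : k[X][X]) :
    eulerForm (P + Q) = (eulerForm P + eulerForm Q : A₁ k) := eval₂_add _ _

theorem eulerForm_monomial (n : ℕ) (a : k[X]) :
    eulerForm (monomial n a) = (pt a * (t * d) ^ n : A₁ k) := eval₂_monomial _ _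

theorem pt_mul_eulerForm (f : k[X]) (P : k[X][X]) :
    (pt f * eulerForm P : A₁ k) = eulerForm (C f * P) := by
  induction P using Polynomial.induction_on' with
  | add p q hp hq => rw [eulerForm_add, mul_add, hp, hq, mul_add, eulerForm_add]
  | monomial n a => rw [C_mul_monomial, eulerForm_monomial, eulerForm_monomial, map_mul, mul_assoc]

theorem exists_euler_mul_eulerForm (P : k[X][X]) :
    ∃ Q, (t * d * eulerForm P : A₁ k) = eulerForm Q := by
  induction P using Polynomial.induction_on' with
  | add p q hp hq =>
    obtain ⟨P', hP⟩ := hp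
    obtain ⟨Q', hQ⟩ := hq
    exact ⟨P' + Q', by rw [eulerForm_add, mul_add, hP, hQ, eulerForm_add]⟩
  | monomial n a =>
    refine ⟨monomial (n + 1) a + monomial n (X * derivative a), ?_⟩
    rw [eulerForm_add, eulerForm_monomial, eulerForm_monomial, eulerForm_monomial, mul_assoc t d,
      ← mul_assoc d, d_mul_pt, map_mul, pt_X, pow_succ', add_mul, mul_add]
    simp only [← mul_assoc, t_comm_pt]

/-- Clearing a power of `t` turns every operator into a polynomial in `t∂`, whose values on
monomials can be read off. -/
theorem exists_t_pow_mul_eq_eulerForm (a : A₁ k) :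
    ∃ K P, pt (X ^ K) * a = (eulerForm P : A₁ k) := by
  suffices h : ∀ x : A₁ k, (∃ K P, pt (X ^ K) * x = (eulerForm P : A₁ k)) →
      ∃ K P, pt (X ^ K) * (a * x) = (eulerForm P : A₁ k) by
    have := h 1 ⟨0, 1, by simp [eulerForm]⟩
    simpa using this
  induction a using weyl_induction with
  | hs c =>
    rintro x ⟨K, P, hP⟩
    refine ⟨K, C (C c) * P, ?_⟩
    rw [← mul_assoc, ← Algebra.commutes, mul_assoc, hP, ← pt_mul_eulerForm,
      ← Polynomial.algebraMap_eq, AlgHom.commutes]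
  | ht =>
    rintro x ⟨K, P, hP⟩
    refine ⟨K, C X * P, ?_⟩
    rw [← pt_mul_eulerForm, ← hP, ← mul_assoc, ← mul_assoc, ← pt_X, pt_comm]
  | hd =>
    rintro x ⟨K, P, hP⟩
    obtain ⟨Q, hQ⟩ := exists_euler_mul_eulerForm P
    -- Because `t^(K+1)∂ = (t∂ - K)t^K`.
    refine ⟨K + 1, Q + C (-(K : k[X])) * P, ?_⟩
    have h1 : (X : k[X]) * derivative (X ^ K) = (K : k[X]) * X ^ K := by
      cases K with
      | zero => simp
      | succ K => rw [derivative_X_pow, map_natCast, Nat.add_sub_cancel]; ring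
    have h2 : (t * d * pt (X ^ K) : A₁ k) = pt (X ^ (K + 1)) * d + pt ((K : k[X]) * X ^ K) := by
      rw [mul_assoc, d_mul_pt, mul_add, ← h1, pow_succ' X, map_mul, map_mul, pt_X, mul_assoc]
    rw [eulerForm_add, ← hQ, ← hP, ← pt_mul_eulerForm, ← hP, ← mul_assoc (t * d), h2, add_mul,
      ← mul_assoc (pt (-(K : k[X]))), ← map_mul, add_assoc, ← add_mul, ← map_add]
    simp [mul_assoc]
  | hmul a b ha hb =>
    intro x hx
    rw [mul_assoc]
    exact ha _ (hb _ hx)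
  | hadd a b ha hb =>
    intro x hx
    obtain ⟨K, P, hP⟩ := ha x hx
    obtain ⟨L, Q, hQ⟩ := hb x hx
    refine ⟨K + L, C (X ^ L) * P + C (X ^ K) * Q, ?_⟩
    have h1 : (pt (X ^ L) * pt (X ^ K) : A₁ k) = pt (X ^ (K + L)) := by
      rw [← map_mul, ← pow_add, add_comm]
    rw [eulerForm_add, ← pt_mul_eulerForm, ← pt_mul_eulerForm, ← hP, ← hQ, ← mul_assoc (pt (X ^ L)),
      ← mul_assoc (pt (X ^ K)) (pt (X ^ L)), pt_comm (X ^ K), h1, ← mul_add, add_mul]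

theorem act_eulerForm_X_pow (P : k[X][X]) (g : ℕ) :
    act (eulerForm P : A₁ k) (X ^ g) = P.eval (C (g : k)) * X ^ g := by
  have h1 : ∀ n : ℕ, act ((t * d : A₁ k) ^ n) (X ^ g) = C ((g : k) ^ n) * X ^ g := by
    intro n
    ext j
    have := coeff_act_euler (X ^ n : k[X]) (X ^ g) j
    rw [map_pow (aeval (t * d : A₁ k)), aeval_X] at this
    rw [this, coeff_C_mul, coeff_X_pow, eval_pow, eval_X]
    split_ifs with h
    · rw [h]
    · simp
  induction P using Polynomial.induction_on' with
  | add p q hp hq => rw [eulerForm_add, map_add, LinearMap.add_apply, hp, hq, eval_add, add_mul]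
  | monomial n a =>
    rw [eulerForm_monomial, map_mul, Module.End.mul_apply, h1, act_pt, eval_monomial, C_pow, mul_assoc]

/-- The operator `∏ (t ∂ - g)` over `g ∈ G`. -/
noncomputable def gapOp (k : Type*) [Field k] (G : Finset ℕ) : A₁ k :=
  aeval (t * d : A₁ k) (∏ g ∈ G, (X - C (g : k)))

theorem coeff_act_gapOp (G : Finset ℕ) (f : k[X]) (j : ℕ) :
    (act (gapOp k G) f).coeff j = (∏ g ∈ G, ((j : k) - g)) * f.coeff j := by
  rw [gapOp, coeff_act_euler, eval_prod]
  simp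

/-- The left ideal of the operators that vanish on a set of polynomials. -/
def annih (F : Set k[X]) : Submodule (A₁ k) (A₁ k) where
  carrier := {a | ∀ f ∈ F, act a f = 0}
  add_mem' {a b} ha hb f hf := by rw [map_add, LinearMap.add_apply, ha f hf, hb f hf, add_zero]
  zero_mem' f _ := by rw [map_zero, LinearMap.zero_apply]
  smul_mem' c a ha f hf := by
    rw [smul_eq_mul, map_mul, Module.End.mul_apply, ha f hf, map_zero]

theorem mem_annih {F : Set k[X]} {a : A₁ k} : a ∈ annih F ↔ ∀ f ∈ F, act a f = 0 := Iff.rfl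

/-- The monomials with exponent in `G`. -/
def gapMonomials (k : Type*) [Field k] (G : Finset ℕ) : Set k[X] := (fun g : ℕ => X ^ g) '' G

/-- `y` is the composite of `x` with the map induced by `a` on the image of `∏ (t ∂ - g)`. -/
def Compat (G : Finset ℕ) (a x y : A₁ k) : Prop :=
  ∀ f h : k[X], act x f = act (gapOp k G) h → act y f = act a h

theorem exists_semilinear_of_mem_stafford {σ : A₁ k ≃ₐ[k] A₁ k} {I : RightIdeal (A₁ k)}
    (h : σ ∈ stafford I) : ∃ F F' : A₁ k → A₁ k,
      (∀ x ∈ I, F x ∈ I) ∧ (∀ x ∈ I, F' x ∈ I) ∧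
      (∀ x ∈ I, ∀ y ∈ I, F (x + y) = F x + F y) ∧ (∀ x ∈ I, ∀ y ∈ I, F' (x + y) = F' x + F' y) ∧
      (∀ x ∈ I, ∀ z, F (x * z) = F x * σ z) ∧ (∀ x ∈ I, ∀ z, F' (x * z) = F' x * σ.symm z) ∧
      (∀ x ∈ I, F' (F x) = x) := by
  classical
  obtain ⟨φ⟩ := h
  have hσ : ∀ x ∈ I, σ x ∈ mapIdeal σ I := fun x hx => ⟨x, hx, rfl⟩
  have hσ' : ∀ y : mapIdeal σ I, σ.symm y.1 ∈ I := by
    rintro ⟨_, x, hx, rfl⟩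
    simpa using hx
  -- `F` is `φ ∘ σ` and `F'` is its inverse, extended by the default value `0` off `I`.
  refine ⟨fun x => if hx : x ∈ I then φ ⟨σ x, hσ x hx⟩ else 0,
    fun x => if hx : x ∈ I then σ.symm (φ.symm ⟨x, hx⟩).1 else 0, ?_, ?_, ?_, ?_, ?_, ?_, ?_⟩
  · intro x hx
    simp only [dif_pos hx]
    exact (φ _).2
  · intro x hx
    simp only [dif_pos hx]
    exact hσ' _
  · intro x hx y hy
    simp only [dif_pos hx, dif_pos hy, dif_pos (I.add_mem hx hy)]
    rw [← Submodule.coe_add, ← map_add]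
    exact congrArg (fun w => (φ w).1) (Subtype.ext (map_add σ x y))
  · intro x hx y hy
    simp only [dif_pos hx, dif_pos hy, dif_pos (I.add_mem hx hy)]
    rw [← map_add, ← Submodule.coe_add, ← map_add]
    rfl
  · intro x hx z
    simp only [dif_pos hx, dif_pos (rightIdeal_mul_mem hx z)]
    refine Eq.trans ?_ (coe_map_mul φ.toLinearMap ⟨σ x, hσ x hx⟩ (σ z)
      (rightIdeal_mul_mem (hσ x hx) _))
    exact congrArg (fun w => (φ w).1) (Subtype.ext (map_mul σ x z))
  · intro x hx z
    simp only [dif_pos hx, dif_pos (rightIdeal_mul_mem hx z)]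
    rw [← map_mul]
    exact congrArg σ.symm (coe_map_mul φ.symm.toLinearMap ⟨x, hx⟩ z (rightIdeal_mul_mem hx z))
  · intro x hx
    simp only [dif_pos hx, SetLike.coe_mem, dif_pos, Subtype.coe_eta, LinearEquiv.symm_apply_apply,
      AlgEquiv.symm_apply_apply]

theorem gapOp_mem_diffOps {G : Finset ℕ} {V : Submodule k k[X]}
    (hV : ∀ f, f ∈ V ↔ ∀ i ∈ G, f.coeff i = 0) : gapOp k G ∈ diffOps V := by
  intro r
  refine (hV _).2 fun i hi => ?_
  rw [coeff_act_gapOp, Finset.prod_eq_zero hi (sub_self _), zero_mul]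

variable [CharZero k]

/-- On `t^g` the operator `t∂` is the scalar `g`, so killing `t^g` makes `g` a root of the Euler
form; factors for distinct `g` are coprime. They have scalar coefficients, so the quotient may stand
on the left. -/
theorem exists_t_pow_mul_eq_mul_gapOp {G : Finset ℕ} {a : A₁ k} (ha : a ∈ annih (gapMonomials k G)) :
    ∃ K b, pt (X ^ K) * a = b * gapOp k G := by
  obtain ⟨K, P, hP⟩ := exists_t_pow_mul_eq_eulerForm a
  have h1 : ∀ g ∈ G, P.eval (C (g : k)) = 0 := by
    intro g hg
    have h2 := act_eulerForm_X_pow P g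
    rw [← hP, map_mul, Module.End.mul_apply, ha _ ⟨g, hg, rfl⟩, map_zero] at h2
    exact (mul_eq_zero.1 h2.symm).resolve_right (pow_ne_zero _ X_ne_zero)
  have h2 : (∏ g ∈ G, (X - C (g : k))).map C ∣ P := by
    rw [Polynomial.map_prod]
    refine Finset.prod_dvd_of_coprime ?_ fun g hg => ?_
    · intro i _ j _ hij
      simp only [Function.onFun, Polynomial.map_sub, map_X, map_C]
      refine isCoprime_X_sub_C_of_isUnit_sub ?_
      rw [← C_sub]
      exact isUnit_C.2 (sub_ne_zero.2 (Nat.cast_injective.ne hij)).isUnit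
    · simp only [Polynomial.map_sub, map_X, map_C]
      exact dvd_iff_isRoot.2 (h1 g hg)
  obtain ⟨Q, hQ⟩ := h2
  refine ⟨K, eulerForm Q, ?_⟩
  have h3 : ∀ c : k, (pt (C c) : A₁ k) = algebraMap k _ c := fun c => by
    rw [← Polynomial.algebraMap_eq, AlgHom.commutes]
  rw [hP, hQ, mul_comm, eulerForm, eval₂_mul_noncomm, eval₂_map]
  · rw [eulerForm, gapOp, aeval_def]
    congr 2
    exact RingHom.ext h3
  · intro i
    rw [coeff_map]
    change Commute (pt (C _)) _
    rw [h3]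
    exact Algebra.commutes _ _

theorem act_gapOp_eq_zero {G : Finset ℕ} {f : k[X]} (hf : act (gapOp k G) f = 0) {i : ℕ}
    (hi : i ∉ G) : f.coeff i = 0 := by
  have h := coeff_act_gapOp G f i
  rw [hf, coeff_zero] at h
  refine (mul_eq_zero.1 h.symm).resolve_left (Finset.prod_ne_zero_iff.2 fun g hg => ?_)
  rw [sub_ne_zero]
  exact Nat.cast_injective.ne fun h => hi (h ▸ hg)

theorem act_eq_zero_of_mem_annih {G : Finset ℕ} {a : A₁ k} (ha : a ∈ annih (gapMonomials k G))
    {f : k[X]} (hf : act (gapOp k G) f = 0) : act a f = 0 := by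
  rw [f.as_sum_support, map_sum]
  refine Finset.sum_eq_zero fun i hi => ?_
  have hiG : i ∈ G := by
    by_contra h
    exact mem_support_iff.1 hi (act_gapOp_eq_zero hf h)
  rw [← C_mul_X_pow_eq_monomial, ← smul_eq_C_mul, map_smul, ha _ ⟨i, hiG, rfl⟩, smul_zero]

end Euler

/-! ### The left ideal dual to `D(R, V)`. -/

section Duality

variable {k : Type*} [Field k] [CharZero k] {G : Finset ℕ} {V : Submodule k k[X]}
  (hV : ∀ f, f ∈ V ↔ ∀ i ∈ G, f.coeff i = 0)

include hV

/-- The eigenvalue `∏ (j - g)` on `t^j` is nonzero for `j ∉ G`, so `V` is contained in the image of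
`gapOp k G`. -/
theorem exists_act_gapOp {f : k[X]} (hf : f ∈ V) : ∃ h, act (gapOp k G) h = f := by
  refine ⟨∑ j ∈ f.support, monomial j ((∏ g ∈ G, ((j : k) - g))⁻¹ * f.coeff j), ?_⟩
  ext j
  rw [coeff_act_gapOp, finsetSum_coeff]
  simp only [coeff_monomial]
  rw [Finset.sum_ite_eq']
  by_cases hj : j ∈ G
  · rw [(hV f).1 hf j hj, Finset.prod_eq_zero hj (sub_self _), zero_mul]
  · have h1 : (∏ g ∈ G, ((j : k) - g)) ≠ 0 := Finset.prod_ne_zero_iff.2 fun g hg => by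
      rw [sub_ne_zero]
      exact Nat.cast_injective.ne fun h => hj (h ▸ hg)
    split_ifs with h
    · rw [← mul_assoc, mul_inv_cancel₀ h1, one_mul]
    · rw [notMem_support_iff.1 h, mul_zero]

/-- With `u = gapOp k G`, the element `y` is formally `a u⁻¹ x`. From `t^K a = bu`, the values of
`bx` are divisible by `t^K`, and the quotient is `y`. -/
theorem exists_compat {a x : A₁ k} (ha : a ∈ annih (gapMonomials k G)) (hx : x ∈ diffOps V) :
    ∃ y, Compat G a x y := by
  obtain ⟨K, b, hb⟩ := exists_t_pow_mul_eq_mul_gapOp ha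
  have h1 : ∀ f h, act x f = act (gapOp k G) h → act (b * x) f = X ^ K * act a h := by
    intro f h hfh
    rw [map_mul, Module.End.mul_apply, hfh, ← Module.End.mul_apply, ← map_mul, ← hb, map_mul,
      Module.End.mul_apply, act_pt]
  obtain ⟨y, hy⟩ := exists_eq_pt_mul (g := X ^ K) (a := b * x) fun f => by
    obtain ⟨h, hh⟩ := exists_act_gapOp hV (hx f)
    rw [h1 f h hh.symm]
    exact dvd_mul_right _ _
  refine ⟨y, fun f h hfh => ?_⟩
  have h2 := h1 f h hfh
  rw [hy, map_mul, Module.End.mul_apply, act_pt] at h2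
  exact mul_left_cancel₀ (pow_ne_zero _ X_ne_zero) h2

theorem Compat.unique {a x y z : A₁ k} (hx : x ∈ diffOps V) (hy : Compat G a x y)
    (hz : Compat G a x z) : y = z := by
  refine act_injective (LinearMap.ext fun f => ?_)
  obtain ⟨h, hh⟩ := exists_act_gapOp hV (hx f)
  rw [hy f h hh.symm, hz f h hh.symm]

/-- A right linear map on `D(R, V)` is determined by its value at `∏ (t ∂ - g)`. -/
theorem compat_of_rightLinear {η : A₁ k → A₁ k}
    (hadd : ∀ x ∈ diffOps V, ∀ y ∈ diffOps V, η (x + y) = η x + η y)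
    (hmul : ∀ x ∈ diffOps V, ∀ z, η (x * z) = η x * z) {x : A₁ k} (hx : x ∈ diffOps V) :
    Compat G (η (gapOp k G)) x (η x) := by
  intro f h hfh
  have hu := gapOp_mem_diffOps hV
  -- The operator `xf - uh` kills `1`, hence equals `z∂`. Since `d/dt` is surjective, `z` lies in
  -- `D(R, V)`, and `η` can be applied to this identity.
  have h0 : act (x * pt f + gapOp k G * pt (-h)) 1 = 0 := by
    rw [map_add, LinearMap.add_apply, map_mul, map_mul, Module.End.mul_apply, Module.End.mul_apply,
      act_pt, act_pt, mul_one, mul_one, hfh, map_neg, add_neg_cancel]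
  have hI := (diffOps V).add_mem (rightIdeal_mul_mem hx (pt f)) (rightIdeal_mul_mem hu (pt (-h)))
  obtain ⟨z, hz⟩ := exists_mul_d_of_act_one h0
  have hzI : z ∈ diffOps V := by
    intro r
    obtain ⟨q, hq⟩ : ∃ q, derivative q = r := by
      refine ⟨r.sum fun n a => monomial (n + 1) (a * (n + 1 : k)⁻¹), ?_⟩
      conv_rhs => rw [r.as_sum_support]
      rw [Polynomial.sum, map_sum]
      refine Finset.sum_congr rfl fun n _ => ?_
      have h2 : (n + 1 : k) ≠ 0 := by exact_mod_cast Nat.succ_ne_zero n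
      rw [derivative_monomial, Nat.add_sub_cancel, mul_assoc]
      push_cast
      rw [inv_mul_cancel₀ h2, mul_one]
    have := hI q
    rwa [hz, map_mul, Module.End.mul_apply, act_d, hq] at this
  have h1 := congrArg η hz
  rw [hadd _ (rightIdeal_mul_mem hx _) _ (rightIdeal_mul_mem hu _), hmul _ hx, hmul _ hu,
    hmul _ hzI] at h1
  have h2 := congrArg (fun a => act a 1) h1
  simp only [map_add act, map_mul act, LinearMap.add_apply, Module.End.mul_apply, act_pt, act_d,
    mul_one, derivative_one, map_zero, map_neg (act _)] at h2
  exact add_neg_eq_zero.1 h2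

/-- `gapOp k G` sends `0` and `t^g` to the same element, so compatibility forces `η(gapOp k G)` to
kill `t^g`. -/
theorem mem_annih_of_rightLinear {η : A₁ k → A₁ k}
    (hadd : ∀ x ∈ diffOps V, ∀ y ∈ diffOps V, η (x + y) = η x + η y)
    (hmul : ∀ x ∈ diffOps V, ∀ z, η (x * z) = η x * z) :
    η (gapOp k G) ∈ annih (gapMonomials k G) := by
  rintro _ ⟨g, hg, rfl⟩
  have h1 := compat_of_rightLinear hV hadd hmul (gapOp_mem_diffOps hV) 0 (X ^ g) ?_
  · rw [← h1, map_zero]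
  · ext j
    rw [map_zero, coeff_act_gapOp, coeff_X_pow]
    split_ifs with h
    · rw [Finset.prod_eq_zero hg (by rw [h, sub_self]), zero_mul, coeff_zero]
    · simp

/-- An automorphism in the Stafford subgroup of `D(R, V)` induces a semilinear bijection of the
left ideal dual to `D(R, V)`. -/
theorem exists_semilinear_annih {σ : A₁ k ≃ₐ[k] A₁ k} (h : σ ∈ stafford (diffOps V)) :
    ∃ s : A₁ k → A₁ k,
      (∀ a ∈ annih (gapMonomials k G), s a ∈ annih (gapMonomials k G)) ∧
      (∀ a ∈ annih (gapMonomials k G), ∀ b ∈ annih (gapMonomials k G), s (a + b) = s a + s b) ∧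
      (∀ c, ∀ a ∈ annih (gapMonomials k G), s (c * a) = σ.symm c * s a) ∧
      (∀ b ∈ annih (gapMonomials k G), ∃ a ∈ annih (gapMonomials k G), s a = b) := by
  classical
  obtain ⟨F, F', hF, hF', hFa, hFa', hFm, hFm', hinv⟩ := exists_semilinear_of_mem_stafford h
  have hu := gapOp_mem_diffOps hV
  have hex : ∀ a x : A₁ k, ∃ y, a ∈ annih (gapMonomials k G) → x ∈ diffOps V → Compat G a x y := by
    intro a x
    by_cases ha : a ∈ annih (gapMonomials k G) ∧ x ∈ diffOps V
    · obtain ⟨y, hy⟩ := exists_compat hV ha.1 ha.2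
      exact ⟨y, fun _ _ => hy⟩
    · exact ⟨0, fun h1 h2 => absurd ⟨h1, h2⟩ ha⟩
  choose H hH using hex
  have Hadd : ∀ a ∈ annih (gapMonomials k G), ∀ x ∈ diffOps V, ∀ y ∈ diffOps V,
      H a (x + y) = H a x + H a y := by
    intro a ha x hx y hy
    refine Compat.unique hV (add_mem hx hy) (hH a _ ha (add_mem hx hy)) fun f q hfq => ?_
    obtain ⟨q1, hq1⟩ := exists_act_gapOp hV (hx f)
    have h2 : act y f = act (gapOp k G) (q - q1) := by
      rw [map_sub, hq1, ← hfq, map_add, LinearMap.add_apply, add_sub_cancel_left]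
    rw [map_add, LinearMap.add_apply, hH a x ha hx f q1 hq1.symm, hH a y ha hy f _ h2, map_sub,
      add_sub_cancel]
  have Hmul : ∀ a ∈ annih (gapMonomials k G), ∀ x ∈ diffOps V, ∀ z, H a (x * z) = H a x * z := by
    intro a ha x hx z
    have hxz := rightIdeal_mul_mem hx z
    refine Compat.unique hV hxz (hH a _ ha hxz) fun f q hfq => ?_
    rw [map_mul, Module.End.mul_apply] at hfq ⊢
    exact hH a x ha hx _ q hfq
  -- `H a` is the right linear map attached to `a`. Twisting it to `σ⁻¹ ∘ H a ∘ F` is again right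
  -- linear, and its value at `gapOp k G` is the new annihilator. Surjectivity uses the inverse
  -- twist `σ ∘ H b ∘ F'`.
  refine ⟨fun a => σ.symm (H a (F (gapOp k G))), ?_, ?_, ?_, ?_⟩
  · intro a ha
    refine mem_annih_of_rightLinear hV (η := fun x => σ.symm (H a (F x))) ?_ ?_
    · intro x hx y hy
      rw [hFa x hx y hy, Hadd a ha _ (hF x hx) _ (hF y hy), map_add]
    · intro x hx z
      rw [hFm x hx, Hmul a ha _ (hF x hx), map_mul, AlgEquiv.symm_apply_apply]
  · intro a ha b hb
    simp only
    rw [← map_add]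
    congr 1
    refine Compat.unique hV (hF _ hu) (hH _ _ (add_mem ha hb) (hF _ hu)) fun f q hfq => ?_
    rw [map_add, map_add, LinearMap.add_apply, LinearMap.add_apply, hH a _ ha (hF _ hu) f q hfq,
      hH b _ hb (hF _ hu) f q hfq]
  · intro c a ha
    simp only
    rw [← map_mul]
    congr 1
    refine Compat.unique hV (hF _ hu) (hH _ _ (Submodule.smul_mem _ c ha) (hF _ hu)) fun f q hfq => ?_
    rw [map_mul, map_mul, Module.End.mul_apply, Module.End.mul_apply, hH a _ ha (hF _ hu) f q hfq]
  · intro b hb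
    have e1 : ∀ x ∈ diffOps V, ∀ y ∈ diffOps V,
        σ (H b (F' (x + y))) = σ (H b (F' x)) + σ (H b (F' y)) := by
      intro x hx y hy
      rw [hFa' x hx y hy, Hadd b hb _ (hF' x hx) _ (hF' y hy), map_add]
    have e2 : ∀ x ∈ diffOps V, ∀ z, σ (H b (F' (x * z))) = σ (H b (F' x)) * z := by
      intro x hx z
      rw [hFm' x hx, Hmul b hb _ (hF' x hx), map_mul, AlgEquiv.apply_symm_apply]
    have e3 := mem_annih_of_rightLinear hV (η := fun x => σ (H b (F' x))) e1 e2
    refine ⟨_, e3, ?_⟩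
    have e4 := compat_of_rightLinear hV (η := fun x => σ (H b (F' x))) e1 e2 (hF _ hu)
    simp only at e3 e4 ⊢
    rw [Compat.unique hV (hF _ hu) (hH _ _ e3 (hF _ hu)) e4, AlgEquiv.symm_apply_apply, hinv _ hu]
    refine Compat.unique hV hu (hH b _ hb hu) fun f q hfq => ?_
    have := act_eq_zero_of_mem_annih hb (f := f - q) (by rw [map_sub, hfq, sub_self])
    rwa [map_sub, sub_eq_zero] at this

end Duality

/-! ### Elements of minimal order in a shear-semilinear left ideal. -/

section LeadingCoefficients

variable {k : Type*} [Field k]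

theorem shear_d_pow_sub (g : k[X]) (j : ℕ) :
    HasLead (shear g (d ^ (j + 1)) - d ^ (j + 1)) j (((j + 1 : ℕ) : k[X]) * g) := by
  induction j with
  | zero =>
    have := hasLead_pt (k := k) g
    simpa using this
  | succ j ih =>
    have h1 := ih.d_mul
    have h2 := hasLead_zero_iff.2 (ih.pt_mul g).mem
    have h3 := hasLead_pt_mul_pow g (j + 1)
    convert (h1.add h2).add h3 using 1
    · rw [pow_succ' d (j + 1), map_mul, shear_d]
      simp only [add_mul, mul_sub]; abel
    · push_cast; ring

theorem shear_sub_mem_Fil (g : k[X]) {m : ℕ} {b : A₁ k} (hb : b ∈ Fil (k := k) (m + 1)) :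
    shear g b - b ∈ Fil (k := k) m := by
  induction m generalizing b with
  | zero =>
    obtain ⟨α, h⟩ := mem_Fil_succ.1 hb
    rw [mem_Fil_zero, pow_zero, mul_one, sub_eq_zero] at h
    rw [h, shear_pt, sub_self]
    exact zero_mem _
  | succ m ih =>
    obtain ⟨α, h⟩ := mem_Fil_succ.1 hb
    have h1 := Fil_le_succ _ (ih h)
    have h2 := ((shear_d_pow_sub g m).pt_mul α).mem
    convert add_mem h1 h2 using 1
    rw [map_sub, map_mul, shear_pt, mul_sub]; abel

theorem HasLead.shear_sub (g : k[X]) {m : ℕ} {b : A₁ k} {β : k[X]} (hb : HasLead b (m + 1) β) :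
    HasLead (shear g b - b) m (((m + 1 : ℕ) : k[X]) * β * g) := by
  have h1 := hasLead_zero_iff.2 (shear_sub_mem_Fil g hb)
  have h2 := (shear_d_pow_sub g m).pt_mul β
  convert h1.add h2 using 1
  · rw [map_sub, map_mul, shear_pt, mul_sub]; abel
  · ring

theorem act_d_pow (m : ℕ) (f : k[X]) : act (d ^ m : A₁ k) f = derivative^[m] f := by
  rw [map_pow, Module.End.pow_apply]
  exact congrFun (congrArg (fun F : k[X] → k[X] => F^[m]) (funext fun r => act_d r)) _

theorem coeff_X_pow_mul_self (p : k[X]) (e : ℕ) : (X ^ e * p).coeff e = p.coeff 0 := by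
  simpa using coeff_X_pow_mul p e 0

/-- An operator of order at most `m` lowers the vanishing order at `0` by at most `m`. -/
theorem X_pow_dvd_act {m e : ℕ} {b : A₁ k} (hb : b ∈ Fil (k := k) (m + 1)) {f : k[X]}
    (hf : X ^ (e + m) ∣ f) : X ^ e ∣ act b f := by
  have hD : ∀ m e, ∀ f : k[X], X ^ (e + m) ∣ f → X ^ e ∣ act (d ^ m : A₁ k) f := by
    intro m
    induction m with
    | zero => intro e f hf; simpa using hf
    | succ m ih =>
      intro e f hf
      rw [pow_succ', map_mul, Module.End.mul_apply, act_d]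
      have h1 := ih (e + 1) f (by rwa [show e + 1 + m = e + (m + 1) by omega])
      obtain ⟨q, hq⟩ := h1
      rw [hq, derivative_mul, derivative_X_pow, Nat.add_sub_cancel]
      exact dvd_add (Dvd.dvd.mul_right (dvd_mul_left _ _) _)
        (Dvd.dvd.mul_right (pow_dvd_pow _ (Nat.le_succ _)) _)
  induction m generalizing b with
  | zero =>
    obtain ⟨α, h⟩ := mem_Fil_succ.1 hb
    rw [mem_Fil_zero, pow_zero, mul_one, sub_eq_zero] at h
    rw [h, act_pt]
    exact hf.mul_left _
  | succ m ih =>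
    obtain ⟨α, h⟩ := mem_Fil_succ.1 hb
    have h1 := ih h ((pow_dvd_pow _ (by omega)).trans hf)
    have h2 := (hD (m + 1) e f hf).mul_left α
    rw [map_sub, LinearMap.sub_apply, map_mul, Module.End.mul_apply, act_pt] at h1
    have := dvd_add h1 h2
    rwa [sub_add_cancel] at this

variable [CharZero k]

theorem mem_Fil_of_pt_mul {f : k[X]} (hf : f ≠ 0) {m : ℕ} {a : A₁ k}
    (h : pt f * a ∈ Fil (k := k) m) : a ∈ Fil (k := k) m := by
  by_cases ha : a = 0
  · rw [ha]; exact zero_mem _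
  obtain ⟨l, α, hα, hl⟩ := exists_hasLead' ha
  by_cases hlm : l < m
  · exact Fil_mono hlm hl.mem
  · exact absurd ((hl.pt_mul f).eq_zero (Fil_mono (by omega) h)) (mul_ne_zero hf hα)

theorem HasLead.of_pt_mul {f : k[X]} (hf : f ≠ 0) {m : ℕ} {a : A₁ k} {γ : k[X]}
    (h : HasLead (pt f * a) m (f * γ)) : HasLead a m γ := by
  refine mem_Fil_of_pt_mul hf ?_
  have h1 := h
  unfold HasLead at h1
  rwa [map_mul, mul_assoc, ← mul_sub] at h1

/-- A left ideal of operators which contains a power of `∂` and is isomorphic to its image under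
`∂ ↦ ∂ - g` has an element of minimal order whose leading coefficient divides a power of `g`. -/
theorem exists_minimal_dvd_pow {Λ : Submodule (A₁ k) (A₁ k)} {g : k[X]} {K : ℕ}
    (hK : (d ^ K : A₁ k) ∈ Λ) {s : A₁ k → A₁ k} (hs : ∀ a ∈ Λ, s a ∈ Λ)
    (hsmul : ∀ c, ∀ a ∈ Λ, s (c * a) = shear g c * s a)
    (hsurj : ∀ b ∈ Λ, ∃ a ∈ Λ, s a = b) :
    ∃ ρ w δ, w ∈ Λ ∧ HasLead w ρ δ ∧ (∀ a ∈ Λ, a ∈ Fil (k := k) ρ → a = 0) ∧ ∃ j, δ ∣ g ^ j := by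
  classical
  have hmul : ∀ (c : A₁ k) {a : A₁ k}, a ∈ Λ → c * a ∈ Λ := fun c a ha => Λ.smul_mem c ha
  have hne : ∃ ρ, ∃ a ∈ Λ, ∃ α, α ≠ 0 ∧ HasLead a ρ α :=
    ⟨K, _, hK, 1, one_ne_zero, hasLead_d_pow K⟩
  obtain ⟨ρ, ⟨a₀, ha₀, α₀, hα₀, hlead₀⟩, hmin⟩ : ∃ ρ, (∃ a ∈ Λ, ∃ α, α ≠ 0 ∧ HasLead a ρ α) ∧
      ∀ l, l < ρ → ¬ ∃ a ∈ Λ, ∃ α, α ≠ 0 ∧ HasLead a l α :=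
    ⟨Nat.find hne, Nat.find_spec hne, fun l hl => Nat.find_min hne hl⟩
  have hzero : ∀ a ∈ Λ, a ∈ Fil (k := k) ρ → a = 0 := by
    intro a ha h
    by_contra h0
    obtain ⟨l, hl, α, hα, hlα⟩ := exists_hasLead h h0
    exact hmin l hl ⟨a, ha, α, hα, hlα⟩
  -- The leading coefficients in the minimal order `ρ` form an ideal; `w` realizes its generator
  -- `δ`.
  let D : Ideal k[X] :=
    { carrier := {α | ∃ a ∈ Λ, HasLead a ρ α}
      add_mem' := by
        rintro α β ⟨a, ha, h⟩ ⟨b, hb, h'⟩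
        exact ⟨a + b, add_mem ha hb, h.add h'⟩
      zero_mem' := ⟨0, zero_mem _, hasLead_zero_iff.2 (zero_mem _)⟩
      smul_mem' := by
        rintro c α ⟨a, ha, h⟩
        exact ⟨pt c * a, hmul _ ha, h.pt_mul c⟩ }
  obtain ⟨δ, hδ⟩ := (IsPrincipalIdealRing.principal D).principal
  have hD : ∀ α, α ∈ D → δ ∣ α := fun α h => by
    rw [hδ] at h
    exact Ideal.mem_span_singleton.1 h
  obtain ⟨w, hw, hwδ⟩ : δ ∈ D := by rw [hδ]; exact Submodule.mem_span_singleton_self δ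
  have hδ0 : δ ≠ 0 := by
    rintro rfl
    exact hα₀ (zero_dvd_iff.1 (hD α₀ ⟨a₀, ha₀, hlead₀⟩))
  have hw0 : w ≠ 0 := hwδ.ne_zero hδ0
  have hmult : ∀ a ∈ Λ, a ∈ Fil (k := k) (ρ + 1) → ∃ c, a = pt c * w := by
    intro a ha h
    obtain ⟨α, h⟩ := mem_Fil_succ_iff_hasLead.1 h
    obtain ⟨c, rfl⟩ := hD α ⟨a, ha, h⟩
    refine ⟨c, sub_eq_zero.1 (hzero _ (sub_mem ha (hmul _ hw)) (hasLead_zero_iff.1 ?_))⟩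
    have := h.sub (hwδ.pt_mul c)
    rwa [mul_comm c, sub_self] at this
  -- Pseudo-division by `w`: after multiplication by a polynomial, the remainder has order below
  -- `ρ`, so it vanishes.
  have hdiv : ∀ m, ∀ a ∈ Λ, a ∈ Fil (k := k) (ρ + m) → ∃ f b, f ≠ 0 ∧ pt f * a = b * w := by
    intro m
    induction m with
    | zero => exact fun a ha h => ⟨1, 0, one_ne_zero, by rw [hzero a ha h, mul_zero, zero_mul]⟩
    | succ m ih =>
      intro a ha h
      obtain ⟨α, h⟩ := mem_Fil_succ_iff_hasLead.1 h
      have h0 := (hwδ.d_pow_mul m).pt_mul α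
      rw [add_comm m ρ] at h0
      have h1 := (h.pt_mul δ).sub h0
      rw [mul_comm α, sub_self, hasLead_zero_iff] at h1
      obtain ⟨f, b, hf, hb⟩ := ih _ (sub_mem (hmul _ ha) (hmul _ (hmul _ hw))) h1
      refine ⟨f * δ, b + pt f * pt α * d ^ m, mul_ne_zero hf hδ0, ?_⟩
      rw [mul_sub, sub_eq_iff_eq_add] at hb
      rw [map_mul, mul_assoc, hb, add_mul]
      simp only [mul_assoc]
  have hdiv' : ∀ a ∈ Λ, ∃ f b, f ≠ 0 ∧ pt f * a = b * w := by
    intro a ha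
    obtain ⟨m, hm⟩ := exists_mem_Fil a
    exact hdiv m a ha (Fil_mono (by omega) hm)
  -- the distinguished generator is preserved up to a scalar
  obtain ⟨r, hr, hsw⟩ : ∃ r : k, r ≠ 0 ∧ s w = pt (C r) * w := by
    obtain ⟨a, ha, hsa⟩ := hsurj w hw
    obtain ⟨f, b, hf, hfb⟩ := hdiv' a ha
    have h1 : pt f * w = shear g b * s w := by
      rw [← hsmul b w hw, ← hfb, hsmul _ a ha, shear_pt, hsa]
    have h2 : pt f * w ≠ 0 := weyl_mul_ne_zero (pt_ne_zero hf) hw0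
    have h3 : s w ≠ 0 := fun h => h2 (by rw [h1, h, mul_zero])
    have h4 : shear g b ≠ 0 := fun h => h2 (by rw [h1, h, zero_mul])
    obtain ⟨l, β, hβ, hl⟩ := exists_hasLead' h3
    obtain ⟨i, ζ, hζ, hi⟩ := exists_hasLead' h4
    have h5 := hwδ.pt_mul f
    rw [h1] at h5
    have h6 := h5.eq_of_ne (hi.mul hl) (mul_ne_zero hf hδ0) (mul_ne_zero hζ hβ)
    have h7 : ¬ l < ρ := fun h => hmin l h ⟨_, hs w hw, β, hβ, hl⟩
    obtain rfl : i = 0 := by omega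
    obtain ⟨c, hc⟩ := hmult (s w) (hs w hw) (Fil_mono (by omega) hl.mem)
    have h8 : b = pt ζ := by
      rw [HasLead, mem_Fil_zero, pow_zero, mul_one, sub_eq_zero] at hi
      exact (shear g).injective (hi.trans (shear_pt g ζ).symm)
    have h9 : a ∈ Fil (k := k) (ρ + 1) := by
      refine mem_Fil_of_pt_mul hf ?_
      rw [hfb, h8]
      exact (hwδ.pt_mul ζ).mem
    obtain ⟨e, he⟩ := hmult a ha h9
    have h10 : pt (e * c) * w = pt 1 * w := by
      rw [map_mul, mul_assoc, ← hc, ← shear_pt g e, ← hsmul _ w hw, ← he, hsa, map_one, one_mul]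
    have h11 := pt_injective (weyl_mul_right_cancel hw0 h10)
    obtain ⟨r, hr, rfl⟩ := Polynomial.isUnit_iff.1 (IsUnit.of_mul_eq_one (a := c) e (by rw [mul_comm, h11]))
    exact ⟨r, hr.ne_zero, hc⟩
  -- Since `fa = bw` and `s w = rw`, `f(s a - ra) = r(shear g b - b)w`. The order drops by one and
  -- the leading coefficient gains a factor `g` up to a unit.
  have hstep : ∀ a ∈ Λ, ∀ m α, HasLead a (ρ + m + 1) α →
      HasLead (s a - pt (C r) * a) (ρ + m) (((m + 1 : ℕ) : k[X]) * C r * α * g) := by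
    intro a ha m α hα
    obtain ⟨f, b, hf, hfb⟩ := hdiv' a ha
    have hb : b ∈ Fil (k := k) (m + 2) := by
      by_cases hb0 : b = 0
      · rw [hb0]; exact zero_mem _
      obtain ⟨i, β, hβ, hi⟩ := exists_hasLead' hb0
      by_contra hbm
      have h1 : ¬ i + 1 ≤ m + 2 := fun h => hbm (Fil_mono h hi.mem)
      have h2 := hi.mul hwδ
      rw [← hfb] at h2
      exact mul_ne_zero hβ hδ0 (h2.eq_zero (Fil_mono (by omega) (hα.pt_mul f).mem))
    obtain ⟨β, hβ⟩ := mem_Fil_succ_iff_hasLead.1 hb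
    have e1 : f * α = β * δ := by
      have h1 := hβ.mul hwδ
      rw [← hfb, show m + 1 + ρ = ρ + m + 1 by omega] at h1
      exact (hα.pt_mul f).unique h1
    have e2 : pt f * (s a - pt (C r) * a) = pt (C r) * ((shear g b - b) * w) := by
      have h1 : pt f * s a = shear g b * (pt (C r) * w) := by
        rw [← hsw, ← hsmul b w hw, ← hfb, hsmul _ a ha, shear_pt]
      have h2 : ∀ z : A₁ k, z * pt (C r) = pt (C r) * z := by
        intro z
        rw [← Polynomial.algebraMap_eq, AlgHom.commutes, Algebra.commutes]
      rw [mul_sub, h1, ← mul_assoc (pt f), h2 (pt f), mul_assoc (pt (C r)), hfb, ← mul_assoc, h2,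
        sub_mul, mul_sub, mul_assoc]
    refine HasLead.of_pt_mul hf ?_
    rw [e2]
    convert ((hβ.shear_sub g).mul hwδ).pt_mul (C r) using 1
    · omega
    · linear_combination (((m + 1 : ℕ) : k[X]) * C r * g) * e1
  -- After `m` such steps the order is at most `ρ`, where `δ` divides. For `∂^K` the initial
  -- coefficient is `1`, which leaves a power of `g`.
  have hall : ∀ m, ∀ a ∈ Λ, ∀ α, HasLead a (ρ + m) α → δ ∣ α * g ^ m := by
    intro m
    induction m with
    | zero =>
      intro a ha α hα
      rw [pow_zero, mul_one]
      exact hD α ⟨a, ha, hα⟩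
    | succ m ih =>
      intro a ha α hα
      have h1 := ih _ (sub_mem (hs a ha) (hmul _ ha)) _ (hstep a ha m α hα)
      have h2 : IsUnit (((m + 1 : ℕ) : k[X]) * C r) := by
        rw [← map_natCast (C : k →+* k[X]), ← C_mul]
        exact isUnit_C.2 (mul_ne_zero (Nat.cast_ne_zero.2 (Nat.succ_ne_zero m)) hr).isUnit
      have h3 : ((m + 1 : ℕ) : k[X]) * C r * α * g * g ^ m =
          (((m + 1 : ℕ) : k[X]) * C r) * (α * g ^ (m + 1)) := by ring
      rw [h3] at h1
      exact h2.dvd_mul_left.1 h1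
  refine ⟨ρ, w, δ, hw, hwδ, hzero, K - ρ, ?_⟩
  have hKρ : ρ ≤ K := by
    by_contra h
    exact hmin K (by omega) ⟨_, hK, 1, one_ne_zero, hasLead_d_pow K⟩
  have := hall (K - ρ) _ hK 1 (by rw [Nat.add_sub_cancel' hKρ]; exact hasLead_d_pow K)
  rwa [one_mul] at this

/-- Each new condition costs one order: `q∂ - q'` kills `q`, where `q` is the value still to be
removed. -/
theorem exists_annihilator (G : Finset ℕ) (φ : ℕ → k[X]) :
    ∃ a : A₁ k, a ≠ 0 ∧ a ∈ Fil (k := k) (G.card + 1) ∧ ∀ i ∈ G, act a (φ i) = 0 := by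
  classical
  induction G using Finset.induction_on with
  | empty =>
    refine ⟨1, ?_, ?_, by simp⟩
    · simpa using pt_ne_zero (k := k) (one_ne_zero)
    · simpa using (hasLead_pt (1 : k[X])).mem
  | insert i G hi ih =>
    obtain ⟨a, h0, ha, hG⟩ := ih
    rw [Finset.card_insert_of_notMem hi]
    by_cases hq : act a (φ i) = 0
    · refine ⟨a, h0, Fil_le_succ _ ha, fun j hj => ?_⟩
      rcases Finset.mem_insert.1 hj with rfl | hj
      · exact hq
      · exact hG j hj
    · set q := act a (φ i) with hqd
      have hL : HasLead (pt q * d - pt (derivative q)) 1 q := by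
        have h1 := hasLead_pt_mul_pow q 1
        have h2 := hasLead_zero_iff.2 (hasLead_pt (derivative q)).mem
        have := h1.sub h2
        rwa [pow_one, sub_zero] at this
      refine ⟨(pt q * d - pt (derivative q)) * a, weyl_mul_ne_zero (hL.ne_zero hq) h0, ?_, ?_⟩
      · have := mul_mem_Fil hL.mem ha
        rwa [show 1 + 1 + G.card = G.card + 1 + 1 by omega] at this
      · intro j hj
        rw [map_mul, Module.End.mul_apply, map_sub, LinearMap.sub_apply, map_mul,
          Module.End.mul_apply, act_pt, act_pt, act_d]
        rcases Finset.mem_insert.1 hj with rfl | hj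
        · rw [← hqd]; ring
        · rw [hG j hj]; simp

/-- An operator of order `ρ` whose leading coefficient is invertible at `0` is injective on the
polynomials divisible by `X ^ ρ`. -/
theorem HasLead.act_ne_zero {w : A₁ k} {ρ : ℕ} {δ : k[X]} (hw : HasLead w ρ δ)
    (hδ : δ.coeff 0 ≠ 0) {f : k[X]} (hf : X ^ ρ ∣ f) (hf0 : f ≠ 0) : act w f ≠ 0 := by
  obtain ⟨f, rfl⟩ := hf
  have hf1 : f ≠ 0 := right_ne_zero_of_mul hf0
  obtain ⟨e, q, hq0, rfl⟩ : ∃ e q, ¬ X ∣ q ∧ f = X ^ e * q := by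
    obtain ⟨q, hq, h⟩ := exists_eq_pow_rootMultiplicity_mul_and_not_dvd f hf1 0
    rw [C_0, sub_zero] at hq h
    exact ⟨_, q, h, hq⟩
  rw [X_dvd_iff] at hq0
  -- For lowest term `t^(ρ+e)`, the lower-order part of `w` has no coefficient at `t^e`, while
  -- `δ∂^ρ` has a nonzero one.
  have h1 : (act (w - pt δ * d ^ ρ) (X ^ ρ * (X ^ e * q))).coeff e = 0 := by
    cases ρ with
    | zero =>
      rw [HasLead, mem_Fil_zero] at hw
      rw [hw, map_zero, LinearMap.zero_apply, coeff_zero]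
    | succ m =>
      have h2 : X ^ (e + 1) ∣ act (w - pt δ * d ^ (m + 1)) (X ^ (m + 1) * (X ^ e * q)) :=
        X_pow_dvd_act hw ⟨q, by ring⟩
      exact X_pow_dvd_iff.1 h2 e (by omega)
  have h3 : act (d ^ ρ : A₁ k) (X ^ ρ * (X ^ e * q)) =
      derivative^[ρ] (X ^ ρ * (X ^ e * q)) := act_d_pow _ _
  have h4 : X ^ e ∣ act (d ^ ρ : A₁ k) (X ^ ρ * (X ^ e * q)) := by
    have h5 : (d ^ ρ : A₁ k) ∈ Fil (k := k) (ρ + 1) := (hasLead_d_pow ρ).mem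
    exact X_pow_dvd_act h5 ⟨q, by ring⟩
  obtain ⟨p, hp⟩ := h4
  have h6 : p.coeff 0 ≠ 0 := by
    have h7 := congrArg (fun F => coeff F e) (h3.symm.trans hp)
    simp only [coeff_iterate_derivative] at h7
    rw [show X ^ ρ * (X ^ e * q) = X ^ (e + ρ) * q by ring, coeff_X_pow_mul_self,
      coeff_X_pow_mul_self] at h7
    rw [← h7, nsmul_eq_mul]
    refine mul_ne_zero (Nat.cast_ne_zero.2 ?_) hq0
    exact (Nat.pos_iff_ne_zero.1 (Nat.descFactorial_pos.2 (by omega)))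
  intro h
  rw [map_sub, LinearMap.sub_apply, h, zero_sub, coeff_neg, neg_eq_zero, map_mul act,
    Module.End.mul_apply, act_pt, hp, mul_left_comm, coeff_X_pow_mul_self, mul_coeff_zero] at h1
  exact mul_ne_zero hδ h6 h1

end LeadingCoefficients

/-! ### Conjugated shears determine the gap set. -/

section Separation

variable {k : Type*} [Field k]

theorem intertwiner_one (σ : A₁ k ≃ₐ[k] A₁ k) : intertwiner σ 1 = 1 := by
  simp [intertwiner_apply]

theorem aeval_X_pow_apply (E : Module.End k k[X]) (m : ℕ) (f : k[X]) :
    aeval E (X ^ m : k[X]) f = E^[m] f := by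
  rw [map_pow, aeval_X, Module.End.pow_apply]

theorem natDegree_aeval_neg_derivative_le (h : k[X]) {f : k[X]} {n : ℕ} (hf : f.natDegree ≤ n) :
    (aeval (-derivative : Module.End k k[X]) h f).natDegree ≤ n := by
  induction h using Polynomial.induction_on generalizing f with
  | C a =>
    rw [aeval_C, Module.algebraMap_end_apply]
    exact (natDegree_smul_le _ _).trans hf
  | add p q hp hq =>
    rw [map_add, LinearMap.add_apply]
    exact natDegree_add_le_of_degree_le (hp hf) (hq hf)
  | monomial m a ih =>
    rw [pow_succ, ← mul_assoc, map_mul, Module.End.mul_apply, aeval_X]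
    refine ih ?_
    rw [LinearMap.neg_apply, natDegree_neg]
    exact (natDegree_derivative_le f).trans (by omega)

theorem card_le_of_subset_Icc {G : Finset ℕ} {N : ℕ} (hG : G ⊆ Finset.Icc 1 N) : G.card ≤ N := by
  simpa using Finset.card_le_card hG

variable [CharZero k]

/-- The automorphism obtained by conjugating `∂ ↦ ∂ + τ(t)` does not stabilize the class of
`D(R, V)` if the twisted gap space contains a polynomial vanishing to high order at `0`. -/
theorem not_mem_stafford {G : Finset ℕ} {V : Submodule k k[X]}
    (hV : ∀ f, f ∈ V ↔ ∀ i ∈ G, f.coeff i = 0) {h g : k[X]} (hg : g.coeff 0 ≠ 0) {i : ℕ}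
    (hi : i ∈ G) (hdvd : X ^ G.card ∣ intertwiner (dualShear h) (X ^ i)) :
    (dualShear h)⁻¹ * shear g * dualShear h ∉ stafford (diffOps V) := by
  intro hσ
  obtain ⟨s, hs, -, hsmul, hsurj⟩ := exists_semilinear_annih hV hσ
  set Ψ := dualShear h with hΨ
  have hΨd : Ψ d = d := dualShear_d h
  set T := intertwiner Ψ with hT
  -- `Ψ` carries the annihilator of the gap monomials to the annihilator of their images under `T`.
  have hmem : ∀ a, a ∈ annih (T '' gapMonomials k G) ↔ Ψ.symm a ∈ annih (gapMonomials k G) := by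
    intro a
    rw [mem_annih, mem_annih, Set.forall_mem_image]
    refine forall₂_congr fun f _ => ?_
    have h1 : T (act (Ψ.symm a) f) = act a (T f) := by
      rw [hT, intertwiner_act hΨd, AlgEquiv.apply_symm_apply]
    rw [← h1, map_eq_zero_iff T (intertwiner_injective hΨd)]
  have hmem' : ∀ a ∈ annih (gapMonomials k G), Ψ a ∈ annih (T '' gapMonomials k G) := by
    intro a ha
    rw [hmem, AlgEquiv.symm_apply_apply]
    exact ha
  obtain ⟨K, hK⟩ : ∃ K, (d ^ K : A₁ k) ∈ annih (T '' gapMonomials k G) := by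
    refine ⟨(G.sup fun i => (T (X ^ i)).natDegree) + 1, ?_⟩
    rintro _ ⟨_, ⟨j, hj, rfl⟩, rfl⟩
    rw [act_d_pow]
    exact iterate_derivative_eq_zero
      (Nat.lt_succ_of_le (Finset.le_sup (f := fun i => (T (X ^ i)).natDegree) hj))
  -- After transport by `Ψ`, the conjugated shear acts as `shear (-g)`.
  have hconj : ∀ c, Ψ (((dualShear h)⁻¹ * shear g * dualShear h).symm (Ψ.symm c)) =
      shear (-g) c := by
    intro c
    rw [← shear_inv]
    refine (shear g).injective (Ψ.symm.injective ?_)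
    have h1 : ∀ y, Ψ.symm (shear g (Ψ y)) = ((dualShear h)⁻¹ * shear g * dualShear h) y :=
      fun y => rfl
    rw [h1, AlgEquiv.apply_symm_apply]
    exact congrArg Ψ.symm ((shear g).apply_symm_apply c).symm
  obtain ⟨ρ, w, δ, hw, hwδ, hmin, j, hj⟩ := exists_minimal_dvd_pow (g := -g) hK
    (s := fun a => Ψ (s (Ψ.symm a)))
    (fun a ha => hmem' _ (hs _ ((hmem a).1 ha)))
    (fun c a ha => by
      rw [map_mul, hsmul _ _ ((hmem a).1 ha), map_mul, hconj])
    (fun b hb => by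
      obtain ⟨a, ha, hab⟩ := hsurj _ ((hmem b).1 hb)
      exact ⟨Ψ a, hmem' a ha, by simp only [AlgEquiv.symm_apply_apply, hab, AlgEquiv.apply_symm_apply]⟩)
  have hδ : δ.coeff 0 ≠ 0 := by
    intro h0
    have h1 := (X_dvd_iff.2 h0).trans hj
    have h2 := X_dvd_iff.1 (prime_X.dvd_of_dvd_pow h1)
    exact hg (neg_eq_zero.1 (by rwa [coeff_neg] at h2))
  obtain ⟨a, ha0, ha, haG⟩ := exists_annihilator G fun i => T (X ^ i)
  -- `|G|` polynomials have a nonzero common annihilator of order at most `|G|`.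
  have hρ : ρ ≤ G.card := by
    by_contra hlt
    refine ha0 (hmin a ?_ (Fil_mono (by omega) ha))
    rintro _ ⟨_, ⟨j, hj, rfl⟩, rfl⟩
    exact haG j hj
  refine hwδ.act_ne_zero hδ ((pow_dvd_pow _ hρ).trans hdvd) ?_ (hw _ ⟨_, ⟨i, hi, rfl⟩, rfl⟩)
  intro h0
  exact pow_ne_zero i X_ne_zero (intertwiner_injective hΨd (h0.trans (map_zero _).symm))

/-- Take `h = t^(N-1)`. Then `T` fixes `t^j` for `j < N`, while `tau h N` is `t^N` plus a nonzero
constant. If `N ∉ G`, the largest gap `i < N` satisfies `|G| ≤ i`, so `T(t^i) = t^i` is divisible by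
`t^|G|`. -/
theorem mem_of_gaps {G : Finset ℕ} {V : Submodule k k[X]}
    (hV : ∀ f, f ∈ V ↔ ∀ i ∈ G, f.coeff i = 0) {N : ℕ} (hG : G ⊆ Finset.Icc 1 N)
    (hne : G.Nonempty)
    (hH : stafford (diffOps (coordRing k (N + 1))) ≤ stafford (diffOps V)) : N ∈ G := by
  by_contra hN
  set i := G.max' hne with hi
  have hiG : i ∈ G := G.max'_mem hne
  have hi1 := Finset.mem_Icc.1 (hG hiG)
  have hiN : i < N := lt_of_le_of_ne hi1.2 fun h => hN (h ▸ hiG)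
  have hcard : G.card ≤ i := card_le_of_subset_Icc fun j hj =>
    Finset.mem_Icc.2 ⟨(Finset.mem_Icc.1 (hG hj)).1, G.le_max' j hj⟩
  obtain ⟨M, rfl⟩ : ∃ M, N = M + 1 := ⟨N - 1, by omega⟩
  have hT : ∀ j, j ≤ M → intertwiner (dualShear (X ^ M : k[X])) (X ^ j) = X ^ j := by
    intro j
    induction j with
    | zero => intro _; rw [pow_zero, intertwiner_one]
    | succ j ih =>
      intro hj
      rw [intertwiner_dualShear_X_pow_succ, ih (by omega), aeval_X_pow_apply,
        iterate_derivative_eq_zero (by rw [natDegree_X_pow]; omega), add_zero, pow_succ']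
  have htau : ∀ j, j ≤ M → tau (X ^ M : k[X]) j = X ^ j := by
    intro j
    induction j with
    | zero => intro _; rw [pow_zero]; rfl
    | succ j ih =>
      intro hj
      rw [tau, ih (by omega), aeval_X_pow_apply, iterate_neg_derivative,
        iterate_derivative_eq_zero (by rw [natDegree_X_pow]; omega), mul_zero, add_zero, pow_succ']
  have h0 : (tau (X ^ M : k[X]) (M + 1)).coeff 0 ≠ 0 := by
    obtain ⟨c, hc, hcM⟩ := iterate_neg_derivative_natDegree (k := k) (b := X ^ M)
      (pow_ne_zero _ X_ne_zero)
    rw [natDegree_X_pow] at hcM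
    rw [tau, htau M le_rfl, aeval_X_pow_apply, hcM]
    simpa using hc
  refine not_mem_stafford hV h0 hiG ?_ (hH (conj_shear_mem_stafford ?_ dvd_rfl))
  · rw [hT i (by omega)]
    exact pow_dvd_pow _ hcard
  · rintro h
    rw [h] at h0
    exact h0 (coeff_zero _)

/-- Here `h` is chosen so that `T(t^N) = t^N + N t^(N-1)`. If `|G| < N` this is divisible by
`t^|G|`, contradicting `not_mem_stafford` at the gap `N`. -/
theorem gaps_eq_Icc {G : Finset ℕ} {V : Submodule k k[X]}
    (hV : ∀ f, f ∈ V ↔ ∀ i ∈ G, f.coeff i = 0) {N : ℕ} (hG : G ⊆ Finset.Icc 1 N)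
    (hN : N ∈ G)
    (hH : stafford (diffOps (coordRing k (N + 1))) ≤ stafford (diffOps V)) :
    G = Finset.Icc 1 N := by
  by_contra hne
  have hcard : G.card < N := by
    have := Finset.card_lt_card (lt_of_le_of_ne hG hne)
    simpa using this
  set h : k[X] := ∑ i ∈ Finset.range (N + 1), (-X) ^ i with hh
  have hgeom : (1 + X) * h = 1 - (-X) ^ (N + 1) := by
    have := mul_neg_geom_sum (-X : k[X]) (N + 1)
    rwa [sub_neg_eq_add] at this
  -- `h` is the truncation of `1/(1+X)`, so `h(E)` inverts `1 + E` on vectors killed by `E^(N+1)`.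
  -- It is used with `E = d/dt` for `T` and `E = -d/dt` for `tau`.
  have hkey : ∀ (E : Module.End k k[X]) (f : k[X]), E^[N + 1] f = 0 →
      aeval E h f + E (aeval E h f) = f ∧ aeval E h (f + E f) = f := by
    intro E f hf
    have h1 : ∀ q : k[X], aeval E ((1 + X) * q) f = aeval E q f + E (aeval E q f) := by
      intro q
      rw [map_mul, Module.End.mul_apply, map_add, map_one, aeval_X]
      rfl
    have h2 : aeval E ((1 + X) * h) f = f := by
      rw [hgeom, map_sub, map_one, LinearMap.sub_apply, neg_pow, map_mul, Module.End.mul_apply,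
        aeval_X_pow_apply, hf, map_zero, sub_zero]
      rfl
    refine ⟨(h1 h).symm.trans h2, ?_⟩
    rw [← h2]
    conv_rhs => rw [mul_comm, map_mul, Module.End.mul_apply, map_add, map_one, aeval_X]
    rw [h2]
    rfl
  have hT : ∀ j, j ≤ N → intertwiner (dualShear h) (X ^ j) = X ^ j + derivative (X ^ j) := by
    intro j
    induction j with
    | zero => intro _; rw [pow_zero, intertwiner_one, derivative_one, add_zero]
    | succ j ih =>
      intro hj
      rw [intertwiner_dualShear_X_pow_succ, ih (by omega), (hkey derivative (X ^ j)
        (iterate_derivative_eq_zero (by rw [natDegree_X_pow]; omega))).2, pow_succ' X j,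
        derivative_mul, derivative_X]
      ring
  have htau : ∀ j, j ≤ N → (tau h j).natDegree ≤ j ∧ tau h j - derivative (tau h j) = X ^ j := by
    intro j
    induction j with
    | zero => intro _; simp [tau]
    | succ j ih =>
      intro hj
      obtain ⟨h1, h2⟩ := ih (by omega)
      have h3 := (hkey (-derivative) (tau h j) (by
        rw [iterate_neg_derivative, iterate_derivative_eq_zero (by omega), mul_zero])).1
      rw [tau]
      constructor
      · refine natDegree_add_le_of_degree_le ?_
          ((natDegree_aeval_neg_derivative_le h h1).trans (Nat.le_succ j))
        exact natDegree_mul_le_of_le natDegree_X_le h1 |>.trans (by omega)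
      · rw [LinearMap.neg_apply] at h3
        rw [derivative_add, derivative_mul, derivative_X, pow_succ', ← h2]
        linear_combination h3
  obtain ⟨h1, h2⟩ := htau N le_rfl
  -- From `τ - τ' = t^N`, the coefficients descend from `1` at `t^N` by `c_i = (i+1)c_(i+1)`, so all
  -- are nonzero, the constant term included.
  have hcoeff : ∀ j, j ≤ N → (tau h N).coeff (N - j) ≠ 0 := by
    intro j
    induction j with
    | zero =>
      intro _
      have h3 := congrArg (fun f => coeff f N) h2
      simp only [coeff_sub, coeff_derivative, coeff_X_pow_self] at h3
      rw [coeff_eq_zero_of_natDegree_lt (by omega : (tau h N).natDegree < N + 1), zero_mul,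
        sub_zero] at h3
      rw [Nat.sub_zero, h3]
      exact one_ne_zero
    | succ j ih =>
      intro hj
      have h3 := congrArg (fun f => coeff f (N - (j + 1))) h2
      simp only [coeff_sub, coeff_derivative, coeff_X_pow] at h3
      rw [if_neg (by omega), sub_eq_zero, show N - (j + 1) + 1 = N - j by omega] at h3
      rw [h3]
      exact mul_ne_zero (ih (by omega)) (Nat.cast_add_one_ne_zero _)
  have h0 : (tau h N).coeff 0 ≠ 0 := by
    have := hcoeff N le_rfl
    rwa [Nat.sub_self] at this
  refine not_mem_stafford hV h0 hN ?_ (hH (conj_shear_mem_stafford ?_ dvd_rfl))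
  · rw [hT N le_rfl, derivative_X_pow]
    exact dvd_add (pow_dvd_pow _ hcard.le) (Dvd.dvd.mul_left (pow_dvd_pow _ (by omega)) _)
  · rintro h
    rw [h] at h0
    exact h0 (coeff_zero _)

theorem eq_coordRing {V : Submodule k k[X]} (hpd : IsPrimaryDecomposable V)
    (hirr : IsIrreducible V) (hproper : V ≠ ⊤) {N : ℕ}
    (hH : stafford (diffOps (coordRing k (N + 1))) ≤ stafford (diffOps V)) :
    1 ≤ N ∧ V = coordRing k (N + 1) := by
  obtain ⟨G, hG, hV⟩ := exists_gaps hpd hirr hH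
  have hne : G.Nonempty := by
    rw [Finset.nonempty_iff_ne_empty]
    rintro rfl
    exact hproper (eq_top_iff.2 fun f _ => (hV f).2 fun i hi => absurd hi (Finset.notMem_empty i))
  have hN := mem_of_gaps hV hG hne hH
  obtain rfl := gaps_eq_Icc hV hG hN hH
  refine ⟨(Finset.mem_Icc.1 hN).1, ?_⟩
  ext f
  rw [hV, mem_coordRing_iff']
  constructor
  · intro hf
    refine ⟨f.coeff 0, X_pow_dvd_iff.2 fun i hi => ?_⟩
    cases i with
    | zero => simp
    | succ i => rw [coeff_sub, coeff_C_succ, sub_zero, hf _ (Finset.mem_Icc.2 ⟨by omega, by omega⟩)]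
  · rintro ⟨c, hc⟩ i hi
    have hi' := Finset.mem_Icc.1 hi
    have := X_pow_dvd_iff.1 hc i (by omega)
    rwa [coeff_sub, coeff_C_of_ne_zero (by omega), sub_zero] at this

end Separation

/-! ### Monomial basis and conductor of `k[X_n]`. -/

section CoordRing

variable {k : Type*} [Field k]

theorem isMonomial_coordRing (n : ℕ) : IsMonomial (coordRing k n) := by
  refine ⟨{i | i = 0 ∨ n ≤ i}, le_antisymm (fun f hf => ?_) (Submodule.span_le.2 ?_)⟩
  · obtain ⟨c, hc⟩ := mem_coordRing_iff'.1 hf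
    rw [f.as_sum_support]
    refine Submodule.sum_mem _ fun i hi => ?_
    rw [← C_mul_X_pow_eq_monomial, ← smul_eq_C_mul]
    refine Submodule.smul_mem _ _ (Submodule.subset_span ⟨i, ?_, rfl⟩)
    by_contra h
    rw [Set.mem_ofPred_eq, not_or] at h
    have := X_pow_dvd_iff.1 hc i (by omega)
    rw [coeff_sub, coeff_C_of_ne_zero h.1, sub_zero] at this
    exact mem_support_iff.1 hi this
  · rintro _ ⟨i, rfl | hi, rfl⟩
    · exact mem_coordRing_iff'.2 ⟨1, by simp⟩
    · exact mem_coordRing_iff'.2 ⟨0, by simpa using pow_dvd_pow X hi⟩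

/-- If `a` is in the conductor, then `aX` has zero coefficient at `t` because `1 < n`; this kills
the constant term of `a`. For `n ≤ 1` the subspace is all of `R`. -/
theorem conductor_coordRing {n : ℕ} (hn : 2 ≤ n) :
    conductor (coordRing k n) = Ideal.span {(X ^ n : k[X])} := by
  ext a
  rw [Ideal.mem_span_singleton]
  constructor
  · intro ha
    obtain ⟨c, hc⟩ := mem_coordRing_iff'.1 (by simpa using ha 1)
    obtain ⟨e, he⟩ := mem_coordRing_iff'.1 (ha X)
    have h1 := X_pow_dvd_iff.1 hc 0 (by omega)
    have h2 := X_pow_dvd_iff.1 he 1 (by omega)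
    rw [coeff_sub, coeff_C_succ, sub_zero, coeff_mul_X] at h2
    rw [coeff_sub, coeff_C_zero, h2, zero_sub, neg_eq_zero] at h1
    rwa [h1, C_0, sub_zero] at hc
  · exact fun h r => mem_coordRing_iff'.2 ⟨0, by simpa using h.mul_right r⟩

end CoordRing

end Weyl

theorem mainTheorem3 {k : Type*} [Field k] [CharZero k] (n : ℕ) (V : Submodule k (Polynomial k))
    (hpd : Weyl.IsPrimaryDecomposable V) (hirr : Weyl.IsIrreducible V) (hproper : V ≠ ⊤)
    (hH : Weyl.stafford (Weyl.diffOps (Weyl.coordRing k n)) ≤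
      Weyl.stafford (Weyl.diffOps V)) :
    Weyl.IsMonomial V ∧
      Weyl.conductor V = Ideal.span {(Polynomial.X ^ n : Polynomial k)} ∧
      V = Weyl.coordRing k n := by
  cases n with
  | zero =>
    -- `k[X_0] = k[X_1] = R`, so `n = 0` falls under `N = 0`, where no gap is possible and `V` could
    -- not be proper.
    rw [Weyl.coordRing_zero_eq] at hH
    exact absurd (Weyl.eq_coordRing hpd hirr hproper hH).1 (by omega)
  | succ N =>
    obtain ⟨hN, rfl⟩ := Weyl.eq_coordRing hpd hirr hproper hH
    exact ⟨Weyl.isMonomial_coordRing _, Weyl.conductor_coordRing (by omega), rfl⟩
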